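/- Let $\mathbb F$ be a finite field of characteristic $\neq 2$, let $C$ be a smooth, projective, geometrically integral curve over $\mathbb F$ with function field $K$, and let $L/K$ be a quadratic extension in which $\mathbb F$ is algebraically closed, with nontrivial automorphism $x\mapsto\bar x$. Let $P$ be a closed point of $C$ of degree $1$ that is unramified and non-split in $L$, i.e. there is exactly one place $Q$ of $L$ above $P$, and $Q$ has degree $2$ over $\mathbb F$. Let $A\subset K$ be the ring of functions whose only poles are at $P$, let $B$ be its integral closure in $L$, let $K_P$ be the completion of $K$ at $P$ with ring of integers $\mathcal O_P$, let $L_Q=L\otimes_K K_P$, and let $\mathcal O_Q$ be the integral closure of $\mathcal O_P$ in $L_Q$, with uniformizer $\pi$. Let $$h(x,y)=x_{-1}\bar y_1+x_0\bar y_0+x_1\bar y_{-1},$$ let $G=\mathrm{SU}(h)$, so that $G(K_P)$ is the group of matrices in $\mathrm{SL}_3(L_Q)$ preserving $h$, and let $G(A)=G(K_P)\cap \mathrm{SL}_3(B)$. Let $X$ be the Bruhat-Tits tree of $G$ over $K_P$, described as follows in terms of $\mathcal O_Q$-lattices in $L_Q^3$. For a lattice $\Lambda$ let $[\Lambda]$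 be its homothety class and $\hat\Lambda=\{x\in L_Q^3 : h(x,\Lambda)\subseteq\mathcal O_Q\}$ its dual; two classes are called adjacent if they have representatives $\Lambda,\Lambda'$ with $\pi\Lambda\subsetneq\Lambda'\subsetneq\Lambda$. The vertices of $X$ are the classes $[M]$ of unimodular lattices ($\hat M=M$) and the unordered pairs $\{[\Lambda],[\hat\Lambda]\}$ of adjacent classes; the neighbors of $[M]$, for $M$ unimodular, are the pairs $\{[\Lambda],[\hat\Lambda]\}$ with $\Lambda$ a maximal proper sublattice of $M$, and there are no other edges. Let $\lambda_0(\infty)\in X$ be the vertex $[\mathcal O_Q^3]$. The group $G(A)$ acts on $X$ without inversions; let $\overline X$ be the quotient graph, whose vertices and oriented edges are the $G(A)$-orbits of vertices and oriented edges of $X$. Then the image of $\lambda_0(\infty)$ in $\overline X$ has valency $3$: exactly three oriented edges of $\overline X$ have it as their source. -/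

import Mathlib

open scoped Pointwise TensorProduct

noncomputable section

namespace UnitaryTree

/-! ### Graphs (with source, target and reverse maps) and quotient graphs -/

/-- A graph: vertices, oriented edges, source, target and reverse maps. -/
structure Graph where
  /-- vertices -/
  V : Type*
  /-- oriented edges -/
  E : Type*
  /-- source -/
  s : E → V
  /-- target -/
  t : E → V
  /-- reverse -/
  r : E → E
  r_ne : ∀ a, r a ≠ a
  r_r : ∀ a, r (r a) = a
  s_r : ∀ a, s (r a) = t a

/-- The valency of a vertex: the number of oriented edges with that source. -/
def Graph.valency (𝔤 : Graph) (x : 𝔤.V) : ℕ∞ := {a : 𝔤.E | 𝔤.s a = x}.encard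

/-- The graph attached to a simple graph: its oriented edges are the darts. -/
def Graph.ofSimple {V : Type*} (X : SimpleGraph V) : Graph where
  V := V
  E := X.Dart
  s a := a.fst
  t a := a.snd
  r a := a.symm
  r_ne a := a.symm_ne
  r_r a := a.symm_symm
  s_r _ := rfl

/-- An action of a group on a graph, without inversions. -/
structure Graph.Action (Γ : Type*) [Group Γ] (𝔤 : Graph) where
  actV : MulAction Γ 𝔤.V
  actE : MulAction Γ 𝔤.E
  smul_s : ∀ (g : Γ) (a : 𝔤.E), 𝔤.s (g • a) = g • 𝔤.s a
  smul_t : ∀ (g : Γ) (a : 𝔤.E), 𝔤.t (g • a) = g • 𝔤.t a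
  smul_r : ∀ (g : Γ) (a : 𝔤.E), 𝔤.r (g • a) = g • 𝔤.r a
  no_inversion : ∀ (g : Γ) (a : 𝔤.E), g • a ≠ 𝔤.r a

/-- The quotient graph: vertices and edges are the orbits of vertices and edges. -/
def Graph.Action.quotient {Γ : Type*} [Group Γ] {𝔤 : Graph} (α : 𝔤.Action Γ) : Graph :=
  letI := α.actV
  letI := α.actE
  { V := MulAction.orbitRel.Quotient Γ 𝔤.V
    E := MulAction.orbitRel.Quotient Γ 𝔤.E
    s := Quotient.map' 𝔤.s (by
      rintro _ b ⟨g, rfl⟩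
      exact ⟨g, (α.smul_s g b).symm⟩)
    t := Quotient.map' 𝔤.t (by
      rintro _ b ⟨g, rfl⟩
      exact ⟨g, (α.smul_t g b).symm⟩)
    r := Quotient.map' 𝔤.r (by
      rintro _ b ⟨g, rfl⟩
      exact ⟨g, (α.smul_r g b).symm⟩)
    r_ne := by
      rintro ⟨a⟩ h
      obtain ⟨g, hg⟩ := Quotient.exact h
      exact α.no_inversion g a hg
    r_r := by
      rintro ⟨a⟩
      exact congrArg (Quotient.mk _) (𝔤.r_r a)
    s_r := by
      rintro ⟨a⟩
      exact congrArg (Quotient.mk _) (𝔤.s_r a) }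

/-- The image of a vertex in the quotient graph. -/
def Graph.Action.mkV {Γ : Type*} [Group Γ] {𝔤 : Graph} (α : 𝔤.Action Γ) (x : 𝔤.V) :
    α.quotient.V :=
  letI := α.actV
  (Quotient.mk (MulAction.orbitRel Γ 𝔤.V) x)

/-! ### The hermitian form and its special unitary group -/

section Hermitian

variable {E : Type*} [CommRing E]

/-- The form `h(x, y) = x₋₁ ȳ₁ + x₀ ȳ₀ + x₁ ȳ₋₁`, where the coordinates `-1, 0, 1` are indexed
by `0, 1, 2` and the bar is the involution `σ`. -/
def herm (σ : E →+* E) (x y : Fin 3 → E) : E :=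
  x 0 * σ (y 2) + x 1 * σ (y 1) + x 2 * σ (y 0)

/-- `SU(h)`: the matrices of determinant one that preserve `h`. -/
def SU (σ : E →+* E) : Subgroup (Matrix.SpecialLinearGroup (Fin 3) E) where
  carrier := {g | ∀ x y, herm σ (g.1.mulVec x) (g.1.mulVec y) = herm σ x y}
  one_mem' x y := by simp
  mul_mem' {a b} ha hb x y := by
    rw [Matrix.SpecialLinearGroup.coe_mul, ← Matrix.mulVec_mulVec, ← Matrix.mulVec_mulVec, ha, hb]
  inv_mem' {a} ha x y := by
    have h (z : Fin 3 → E) : a.1.mulVec ((a⁻¹).1.mulVec z) = z := by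
      rw [Matrix.mulVec_mulVec, ← Matrix.SpecialLinearGroup.coe_mul, mul_inv_cancel]
      simp
    have h1 := ha ((a⁻¹).1.mulVec x) ((a⁻¹).1.mulVec y)
    rw [h, h] at h1
    exact h1.symm

/-! ### Lattices -/

variable (O : Subring E)

/-- The `O`-lattices in `E³`: finitely generated `O`-submodules that span `E³` over `E`. -/
def Lattice : Type _ := {Λ : Submodule O (Fin 3 → E) // Λ.IsLattice E}

variable {O}

/-- The `E`-linear automorphism of `E³` given by a matrix, viewed as an `O`-linear map. -/
def matAct (O : Subring E) (g : Matrix.SpecialLinearGroup (Fin 3) E) :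
    (Fin 3 → E) →ₗ[O] (Fin 3 → E) :=
  (Matrix.mulVecLin g.1).restrictScalars O

@[simp] lemma matAct_apply (g : Matrix.SpecialLinearGroup (Fin 3) E) (x : Fin 3 → E) :
    matAct O g x = g.1.mulVec x := rfl

lemma matAct_one : matAct O (1 : Matrix.SpecialLinearGroup (Fin 3) E) = LinearMap.id := by
  refine LinearMap.ext fun x => ?_
  simp

lemma matAct_mul (g g' : Matrix.SpecialLinearGroup (Fin 3) E) :
    matAct O (g * g') = matAct O g ∘ₗ matAct O g' := by
  refine LinearMap.ext fun x => ?_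
  simp [Matrix.mulVec_mulVec]

lemma matAct_inv_cancel (g : Matrix.SpecialLinearGroup (Fin 3) E) (x : Fin 3 → E) :
    g.1.mulVec ((g⁻¹).1.mulVec x) = x := by
  rw [Matrix.mulVec_mulVec, ← Matrix.SpecialLinearGroup.coe_mul, mul_inv_cancel]
  simp

lemma matAct_injective (g : Matrix.SpecialLinearGroup (Fin 3) E) :
    Function.Injective (matAct O g) := by
  intro x y h
  have := congrArg ((g⁻¹).1.mulVec) h
  have hh := matAct_inv_cancel g⁻¹
  rw [inv_inv] at hh
  simpa only [matAct_apply, hh] using this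

lemma isLattice_map (g : Matrix.SpecialLinearGroup (Fin 3) E) {Λ : Submodule O (Fin 3 → E)}
    (h : Λ.IsLattice E) : (Λ.map (matAct O g)).IsLattice E where
  fg := h.fg.map _
  span_eq_top := by
    have h1 : ((Λ.map (matAct O g) : Submodule O (Fin 3 → E)) : Set (Fin 3 → E))
        = (Matrix.mulVecLin g.1) '' (Λ : Set (Fin 3 → E)) := rfl
    rw [h1, Submodule.span_image, h.span_eq_top, Submodule.map_top, LinearMap.range_eq_top]
    exact fun x => ⟨_, matAct_inv_cancel g x⟩

/-- `gΛ`, the image of a lattice under a matrix. -/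
instance : MulAction (Matrix.SpecialLinearGroup (Fin 3) E) (Lattice O) where
  smul g Λ := ⟨Λ.1.map (matAct O g), isLattice_map g Λ.2⟩
  one_smul Λ := Subtype.ext (by
    change Λ.1.map (matAct O 1) = Λ.1
    rw [matAct_one, Submodule.map_id])
  mul_smul g g' Λ := Subtype.ext (by
    change Λ.1.map (matAct O (g * g')) = (Λ.1.map (matAct O g')).map (matAct O g)
    rw [matAct_mul, Submodule.map_comp])

lemma coe_smul (g : Matrix.SpecialLinearGroup (Fin 3) E) (Λ : Lattice O) :
    (g • Λ).1 = Λ.1.map (matAct O g) := rfl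

/-- `cΛ`, the homothetic image of a lattice under a unit `c` of `E`. -/
instance : MulAction Eˣ (Lattice O) where
  smul c Λ := ⟨c • Λ.1, haveI := Λ.2; inferInstance⟩
  one_smul Λ := Subtype.ext (one_smul Eˣ Λ.1)
  mul_smul c c' Λ := Subtype.ext (mul_smul c c' Λ.1)

lemma coe_units_smul (c : Eˣ) (Λ : Lattice O) : (c • Λ).1 = c • Λ.1 := rfl

lemma map_smul_lattice {S : Type*} [Monoid S] [DistribMulAction S (Fin 3 → E)]
    [SMulCommClass S O (Fin 3 → E)] (c : S) (g : Matrix.SpecialLinearGroup (Fin 3) E)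
    (hc : ∀ x, matAct O g (c • x) = c • matAct O g x) (Λ : Submodule O (Fin 3 → E)) :
    (c • Λ).map (matAct O g) = c • Λ.map (matAct O g) := by
  ext y
  simp only [Submodule.mem_map, Submodule.mem_smul_pointwise_iff_exists]
  constructor
  · rintro ⟨_, ⟨x, hx, rfl⟩, rfl⟩
    exact ⟨_, ⟨x, hx, rfl⟩, (hc x).symm⟩
  · rintro ⟨_, ⟨x, hx, rfl⟩, rfl⟩
    exact ⟨_, ⟨x, hx, rfl⟩, hc x⟩

instance : SMulCommClass (Matrix.SpecialLinearGroup (Fin 3) E) Eˣ (Lattice O) where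
  smul_comm g c Λ := Subtype.ext (map_smul_lattice c g
    (fun x => by simp [Units.smul_def, Matrix.mulVec_smul]) Λ.1)

variable (O) in
/-- Homothety classes `[Λ]` of lattices. -/
def LatticeClass : Type _ := MulAction.orbitRel.Quotient Eˣ (Lattice O)

/-- The class `[Λ]`. -/
def Lattice.cls (Λ : Lattice O) : LatticeClass O := Quotient.mk (MulAction.orbitRel Eˣ (Lattice O)) Λ

instance : MulAction (Matrix.SpecialLinearGroup (Fin 3) E) (LatticeClass O) where
  smul g := Quotient.map' (g • ·) (by
    rintro _ Λ ⟨c, rfl⟩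
    exact ⟨c, (smul_comm g c Λ).symm⟩)
  one_smul := by
    rintro ⟨Λ⟩
    exact congrArg (Quotient.mk _) (one_smul _ Λ)
  mul_smul g g' := by
    rintro ⟨Λ⟩
    exact congrArg (Quotient.mk _) (mul_smul g g' Λ)

lemma smul_cls (g : Matrix.SpecialLinearGroup (Fin 3) E) (Λ : Lattice O) :
    g • Λ.cls = (g • Λ).cls := rfl

/-- Adjacency of classes in the building of `SL₃`: `[Λ]` and `[Λ']` are neighbors if, for suitable
representatives, `πΛ ⊊ Λ' ⊊ Λ`, with `π` a uniformizer (a prime element) of `O`. -/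
def BuildingAdj (c c' : LatticeClass O) : Prop :=
  ∃ Λ Λ' : Lattice O, Λ.cls = c ∧ Λ'.cls = c' ∧
    ∃ π : O, Irreducible π ∧ π • Λ.1 < Λ'.1 ∧ Λ'.1 < Λ.1

lemma BuildingAdj.smul {c c' : LatticeClass O} (h : BuildingAdj c c')
    (g : Matrix.SpecialLinearGroup (Fin 3) E) : BuildingAdj (g • c) (g • c') := by
  obtain ⟨Λ, Λ', rfl, rfl, π, hπ, h1, h2⟩ := h
  have hm := Submodule.map_strictMono_of_injective (matAct_injective (O := O) g)
  refine ⟨g • Λ, g • Λ', rfl, rfl, π, hπ, ?_, hm h2⟩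
  have h3 := hm h1
  rw [map_smul_lattice π g (fun x => map_smul _ _ _)] at h3
  exact h3

/-! ### The dual lattice -/

/-- `Λ̂ = {x | h(x, Λ) ⊆ O}`. -/
def dual (σ : E →+* E) (Λ : Submodule O (Fin 3 → E)) : Set (Fin 3 → E) :=
  {x | ∀ y ∈ Λ, herm σ x y ∈ O}

/-- `Λ'` is the dual lattice of `Λ`. -/
def IsDual (σ : E →+* E) (Λ Λ' : Lattice O) : Prop :=
  (Λ'.1 : Set (Fin 3 → E)) = dual σ Λ.1

lemma IsDual.smul {σ : E →+* E} {Λ Λ' : Lattice O} (h : IsDual σ Λ Λ')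
    (g : Matrix.SpecialLinearGroup (Fin 3) E) (hg : g ∈ SU σ) : IsDual σ (g • Λ) (g • Λ') := by
  unfold IsDual at h ⊢
  ext x
  have h1 : x ∈ ((g • Λ').1 : Set (Fin 3 → E)) ↔
      (g⁻¹).1.mulVec x ∈ (Λ'.1 : Set (Fin 3 → E)) := by
    constructor
    · rintro ⟨y, hy, rfl⟩
      have hh := matAct_inv_cancel g⁻¹ y
      rw [inv_inv] at hh
      rwa [matAct_apply, hh]
    · intro hx
      exact ⟨_, hx, matAct_inv_cancel g x⟩
  rw [h1, h]
  constructor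
  · rintro hx _ ⟨y, hy, rfl⟩
    have h2 := hx y hy
    rw [← hg, matAct_inv_cancel] at h2
    exact h2
  · intro hx y hy
    rw [← hg, matAct_inv_cancel]
    exact hx _ ⟨y, hy, rfl⟩

/-- The class contains a unimodular (i.e. self-dual) lattice. -/
def IsUnimodular (σ : E →+* E) (c : LatticeClass O) : Prop :=
  ∃ M : Lattice O, M.cls = c ∧ IsDual σ M M

/-- The unordered pair consists of two mutually dual neighboring classes `[Λ]`, `[Λ̂]`. -/
def IsDualPair (σ : E →+* E) (p : Sym2 (LatticeClass O)) : Prop :=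
  ∃ Λ Λ' : Lattice O, IsDual σ Λ Λ' ∧ BuildingAdj Λ.cls Λ'.cls ∧ p = s(Λ.cls, Λ'.cls)

/-- The vertices of the tree of `SU(h)`: classes of unimodular lattices, and pairs of neighboring
classes of the form `([Λ], [Λ̂])`. -/
inductive Vertex (O : Subring E) (σ : E →+* E)
  | unimodular (c : LatticeClass O) (hc : IsUnimodular σ c)
  | pair (p : Sym2 (LatticeClass O)) (hp : IsDualPair σ p)

/-- The class `c` of a unimodular lattice `M` and the pair `p` are neighbors: `p = ([Λ], [Λ̂])` for
a maximal proper sublattice `Λ` of `M` (it is integral because `M` is, and `M ⊆ Λ̂`). -/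
def Incident (σ : E →+* E) (c : LatticeClass O) (p : Sym2 (LatticeClass O)) : Prop :=
  ∃ M Λ Λ' : Lattice O, IsDual σ M M ∧ IsDual σ Λ Λ' ∧ Λ.1 ⋖ M.1 ∧
    M.cls = c ∧ p = s(Λ.cls, Λ'.cls)

/-- The tree of `SU(h)`, as a simple graph. -/
def tree (O : Subring E) (σ : E →+* E) : SimpleGraph (Vertex O σ) where
  Adj x y := match x, y with
    | .unimodular c _, .pair p _ => Incident σ c p
    | .pair p _, .unimodular c _ => Incident σ c p
    | _, _ => False
  symm := ⟨by
    rintro (_ | _) (_ | _) h <;> exact h⟩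
  loopless := ⟨by
    rintro (_ | _) h <;> exact h⟩

variable {σ : E →+* E}

lemma IsUnimodular.smul {c : LatticeClass O} (h : IsUnimodular σ c) (g : SU σ) :
    IsUnimodular σ (g • c) := by
  obtain ⟨M, rfl, hM⟩ := h
  exact ⟨g.1 • M, rfl, hM.smul g.1 g.2⟩

lemma IsDualPair.smul {p : Sym2 (LatticeClass O)} (h : IsDualPair σ p) (g : SU σ) :
    IsDualPair σ (p.map (g • ·)) := by
  obtain ⟨Λ, Λ', h1, h2, rfl⟩ := h
  exact ⟨g.1 • Λ, g.1 • Λ', h1.smul g.1 g.2, h2.smul g.1, rfl⟩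

lemma Incident.smul {c : LatticeClass O} {p : Sym2 (LatticeClass O)} (h : Incident σ c p)
    (g : SU σ) : Incident σ (g • c) (p.map (g • ·)) := by
  obtain ⟨M, Λ, Λ', h1, h2, h3, rfl, rfl⟩ := h
  refine ⟨g.1 • M, g.1 • Λ, g.1 • Λ', h1.smul g.1 g.2, h2.smul g.1 g.2, ?_, rfl, rfl⟩
  have hsurj : Function.Surjective (matAct O g.1) := fun x => ⟨_, matAct_inv_cancel g.1 x⟩
  let e := LinearEquiv.ofBijective (matAct O g.1) ⟨matAct_injective g.1, hsurj⟩
  exact (apply_covBy_apply_iff (Submodule.orderIsoMapComap e)).2 h3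

/-- The action of `SU(h)` on the vertices. -/
instance : MulAction (SU σ) (Vertex O σ) where
  smul g x := match x with
    | .unimodular c hc => .unimodular (g • c) (hc.smul g)
    | .pair p hp => .pair (p.map (g • ·)) (hp.smul g)
  one_smul := by
    rintro (⟨c, hc⟩ | ⟨p, hp⟩)
    · change Vertex.unimodular ((1 : SU σ) • c) _ = _
      congr 1
      exact one_smul _ c
    · change Vertex.pair (p.map ((1 : SU σ) • ·)) _ = _
      congr 1
      simp only [one_smul]
      exact congrFun Sym2.map_id' p
  mul_smul g g' := by
    rintro (⟨c, hc⟩ | ⟨p, hp⟩)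
    · change Vertex.unimodular ((g * g') • c) _ = Vertex.unimodular (g • g' • c) _
      congr 1
      exact mul_smul g g' c
    · change Vertex.pair (p.map ((g * g') • ·)) _ = Vertex.pair ((p.map (g' • ·)).map (g • ·)) _
      congr 1
      rw [Sym2.map_map]
      congr 1
      funext c
      exact mul_smul g g' c

lemma tree_adj_smul (g : SU σ) {x y : Vertex O σ} (h : (tree O σ).Adj x y) :
    (tree O σ).Adj (g • x) (g • y) := by
  rcases x with _ | _ <;> rcases y with _ | _
  · exact h.elim
  · exact Incident.smul h g
  · exact Incident.smul h g
  · exact h.elim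

/-- The action of a subgroup `Γ` of `SU(h)` on the tree. -/
def treeAction (O : Subring E) (Γ : Subgroup (SU σ)) :
    (Graph.ofSimple (tree O σ)).Action Γ where
  actV := inferInstanceAs (MulAction Γ (Vertex O σ))
  actE :=
    { smul := fun g a => ⟨(g • a.fst, g • a.snd), tree_adj_smul g.1 a.adj⟩
      one_smul := fun a => SimpleGraph.Dart.ext _ _
        (Prod.ext (one_smul Γ a.fst) (one_smul Γ a.snd))
      mul_smul := fun g g' a => SimpleGraph.Dart.ext _ _
        (Prod.ext (mul_smul g g' a.fst) (mul_smul g g' a.snd)) }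
  smul_s _ _ := rfl
  smul_t _ _ := rfl
  smul_r _ _ := rfl
  no_inversion g a h := by
    have h1 : g • a.fst = a.snd :=
      congrArg (fun d : (tree O σ).Dart => d.fst) h
    have h2 := a.adj
    rw [← h1] at h2
    rcases hx : a.fst with _ | _ <;> rw [hx] at h2 <;> exact h2

/-- The standard lattice `Λ₀ = O³`. -/
def stdSubmodule (O : Subring E) : Submodule O (Fin 3 → E) where
  carrier := {x | ∀ i, x i ∈ O}
  add_mem' hx hy i := O.add_mem (hx i) (hy i)
  zero_mem' _ := O.zero_mem
  smul_mem' c _ hx i := O.mul_mem c.2 (hx i)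

lemma stdSubmodule_eq_span (O : Subring E) :
    stdSubmodule O = Submodule.span O (Set.range fun i : Fin 3 => (Pi.single i 1 : Fin 3 → E)) := by
  refine le_antisymm (fun x hx => ?_) (Submodule.span_le.2 ?_)
  · have h1 : x = ∑ i, (⟨x i, hx i⟩ : O) • (Pi.single i 1 : Fin 3 → E) := by
      funext j
      simp [Finset.sum_apply, Pi.single_apply, Subring.smul_def]
    rw [h1]
    exact Submodule.sum_mem _ fun i _ =>
      Submodule.smul_mem _ _ (Submodule.subset_span ⟨i, rfl⟩)
  · rintro _ ⟨i, rfl⟩ j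
    by_cases h : j = i
    · subst h
      simp
    · simp only [Pi.single_apply, h, if_false]
      exact O.zero_mem

/-- The lattice `Λ₀ = O³`. -/
def stdLattice (O : Subring E) : Lattice O :=
  ⟨stdSubmodule O,
    { fg := by
        rw [stdSubmodule_eq_span]
        exact Submodule.fg_span (Set.finite_range _)
      span_eq_top := by
        rw [eq_top_iff]
        intro x _
        have h1 : x = ∑ i, x i • (Pi.single i 1 : Fin 3 → E) := by
          funext j
          simp [Finset.sum_apply, Pi.single_apply]
        rw [h1]
        refine Submodule.sum_mem _ fun i _ => Submodule.smul_mem _ _ (Submodule.subset_span ?_)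
        change Pi.single i 1 ∈ stdSubmodule O
        rw [stdSubmodule_eq_span]
        exact Submodule.subset_span ⟨i, rfl⟩ }⟩

lemma stdLattice_isDual (O : Subring E) (hσ : ∀ x ∈ O, σ x ∈ O) :
    IsDual σ (stdLattice O) (stdLattice O) := by
  unfold IsDual
  ext x
  constructor
  · intro hx y hy
    exact O.add_mem (O.add_mem (O.mul_mem (hx 0) (hσ _ (hy 2))) (O.mul_mem (hx 1) (hσ _ (hy 1))))
      (O.mul_mem (hx 2) (hσ _ (hy 0)))
  · intro hx i
    have key (j : Fin 3) : herm σ x (Pi.single j 1) ∈ O := by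
      refine hx _ ?_
      change Pi.single j 1 ∈ stdSubmodule O
      rw [stdSubmodule_eq_span]
      exact Submodule.subset_span ⟨j, rfl⟩
    have k0 := key 0
    have k1 := key 1
    have k2 := key 2
    simp [herm] at k0 k1 k2
    fin_cases i
    · exact k2
    · exact k1
    · exact k0

/-- The special vertex `λ₀(∞)`: the class of the unimodular lattice `Λ₀ = O³`. -/
def specialVertex (O : Subring E) (σ : E →+* E) (hσ : ∀ x ∈ O, σ x ∈ O) : Vertex O σ :=
  .unimodular (stdLattice O).cls ⟨stdLattice O, rfl, stdLattice_isDual O hσ⟩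

end Hermitian

/-! ### Function fields of curves and their places -/

/-- `K` is an algebraic function field in one variable over `F`: a finitely generated field
extension of transcendence degree one. -/
def IsCurveFunctionField (F K : Type*) [Field F] [Field K] [Algebra F K] : Prop :=
  (⊤ : IntermediateField F K).FG ∧ Algebra.trdeg F K = 1

/-- A place of `K/F`: a valuation ring of `K` that contains `F` and is not `K`. The places of the
function field of a smooth projective curve are the local rings of its closed points. -/
structure Place (F K : Type*) [Field F] [Field K] [Algebra F K] where
  /-- the valuation ring -/
  ring : ValuationSubring K
  algebraMap_mem : ∀ a : F, algebraMap F K a ∈ ring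
  ne_top : ring ≠ ⊤

section Place

variable {F K : Type*} [Field F] [Field K] [Algebra F K]

instance (P : Place F K) : Algebra F P.ring :=
  ((algebraMap F K).codRestrict P.ring.toSubring P.algebraMap_mem).toAlgebra

/-- The degree of a place: the degree over `F` of its residue field. -/
def Place.degree (P : Place F K) : ℕ := Module.finrank F (IsLocalRing.ResidueField P.ring)

/-- `A ⊆ K`: the functions whose only poles are at `P`. -/
def Place.affineRing (P : Place F K) : Subring K where
  carrier := {f | ∀ P' : Place F K, P' ≠ P → f ∈ P'.ring}
  mul_mem' hf hg P' h := P'.ring.mul_mem _ _ (hf P' h) (hg P' h)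
  one_mem' P' _ := P'.ring.one_mem
  add_mem' hf hg P' h := P'.ring.add_mem _ _ (hf P' h) (hg P' h)
  zero_mem' P' _ := P'.ring.zero_mem
  neg_mem' hf P' h := P'.ring.neg_mem _ (hf P' h)

variable (P : Place F K) [IsDiscreteValuationRing P.ring]

/-- `K_P`: the completion of `K` at `P`. -/
abbrev Place.Completion : Type _ := (IsDiscreteValuationRing.maximalIdeal P.ring).adicCompletion K

/-- `O_P`: the ring of integers of `K_P`. -/
abbrev Place.integers : ValuationSubring P.Completion :=
  (IsDiscreteValuationRing.maximalIdeal P.ring).adicCompletionIntegers K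

variable (L : Type*) [Field L] [Algebra K L]

/-- `B`: the integral closure of `A` in `L`. -/
def Place.integralRing : Subring L := (integralClosure P.affineRing L).toSubring

/-- `L_Q = K_P ⊗_K L`. -/
abbrev Place.localAlgebra : Type _ := P.Completion ⊗[K] L

/-- `O_Q`: the integral closure of `O_P` in `L_Q`. -/
def Place.localIntegers : Subring (P.localAlgebra L) :=
  (integralClosure P.integers (P.localAlgebra L)).toSubring

variable {L}

/-- The involution of `L_Q = K_P ⊗_K L` induced by an automorphism `τ` of `L/K`. -/
def Place.conj (τ : L ≃ₐ[K] L) : P.localAlgebra L →ₐ[P.Completion] P.localAlgebra L :=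
  Algebra.TensorProduct.map (AlgHom.id P.Completion P.Completion) τ.toAlgHom

lemma Place.conj_mem (τ : L ≃ₐ[K] L) (x : P.localAlgebra L) (hx : x ∈ P.localIntegers L) :
    P.conj τ x ∈ P.localIntegers L :=
  IsIntegral.map ((P.conj τ).restrictScalars P.integers) hx

/-- `G(K_P)`: the special unitary group of `h` over `L_Q`. -/
abbrev Place.localGroup (τ : L ≃ₐ[K] L) :
    Subgroup (Matrix.SpecialLinearGroup (Fin 3) (P.localAlgebra L)) :=
  SU (P.conj τ).toRingHom

/-- `G(A)`: the elements of `G(K_P)` whose coefficients lie in `B`. -/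
def Place.arithmeticGroup (τ : L ≃ₐ[K] L) : Subgroup (P.localGroup τ) :=
  (Matrix.SpecialLinearGroup.map
    ((Algebra.TensorProduct.includeRight : L →ₐ[K] P.localAlgebra L).toRingHom.comp
      (P.integralRing L).subtype)).range.subgroupOf (P.localGroup τ)

/-- The tree `X` of `G` over `K_P`. -/
def Place.bruhatTitsTree (τ : L ≃ₐ[K] L) : Graph :=
  Graph.ofSimple (tree (P.localIntegers L) (P.conj τ).toRingHom)

/-- The action of `G(A)` on `X`. -/
def Place.arithmeticAction (τ : L ≃ₐ[K] L) : (P.bruhatTitsTree τ).Action (P.arithmeticGroup τ) :=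
  treeAction (P.localIntegers L) (P.arithmeticGroup τ)

/-- The quotient graph of `X` by `G(A)`. -/
def Place.quotientGraph (τ : L ≃ₐ[K] L) : Graph := (P.arithmeticAction τ).quotient

/-- The image of `λ₀(∞)` in the quotient graph. -/
def Place.specialVertexImage (τ : L ≃ₐ[K] L) : (P.quotientGraph τ).V :=
  (P.arithmeticAction τ).mkV
    (specialVertex (P.localIntegers L) (P.conj τ).toRingHom (P.conj_mem τ))

end Place

end UnitaryTree

end

/-! Let `k` be the residue field of `O_Q`, a quadratic extension of the finite field `F`. Modulo the
uniformizer, a maximal sublattice of `O³` is a plane of `k³`, the orthogonal of a point `w` for the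
reduced form; its dual is `O³ + ϖ⁻¹Ow`. The classes of the two are adjacent exactly when `w` is
isotropic. So the edges at `[O³]` are the `k`-points of the hermitian curve `h(v, v) = 0`
(`IsotropicVector.exists_dart`, `IsotropicVector.dart_eq_iff`).

An element of `G(A)` fixing `[O³]` preserves `O³`, so its entries lie in `B` and are integral at
`P`. The trace and norm of such an entry are functions without poles, so the entry is algebraic over
`F` and hence constant (`Place.exists_const_of_mem_localIntegers`). As the bar is trivial on `F`,
the stabilizer is `SO₃(F)` for the form `q(x) = h(x, x) = 2x₋₁x₁ + x₀²`.

It remains to count the orbits of `SO₃(F)` on the hermitian curve. The class of `q(v)` modulo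
squares of `k` depends only on the point and is invariant; it is also complete
(`IsQuadratic.exists_isometry_of_form`). If `q(v) ≠ 0`, write `v = a + εb` over `F`: the values
`h(v, v) = 0` and `q(v)` determine the Gram matrix of `(a, b)`, and `exists_isometry` moves one such
pair to another. If `q(v) = 0`, then `v` and its conjugate span a totally isotropic space, so the
point is an `F`-point of the conic `q = 0`, on which `SO₃(F)` is transitive. Zero, the squares and
the nonsquares all occur (`IsQuadratic.exists_isotropic`), which gives three orbits.

The local input is `Place.exists_isUnramifiedDatum`: `L` contains `θ` with `τθ = -θ` and `θ²`
congruent at `P` to a constant `d` that is not a square, so that `O_Q = O_P ⊕ O_P θ`. -/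

namespace UnitaryTree

/-! ### The orbits of `SO₃(F)` on the isotropic points of a hermitian plane over a quadratic
extension -/

section Isometry

variable {F : Type*} [Field F]

/-- An isometry between nondegenerate planes of the split quadratic space of dimension three extends
to an isometry of determinant one. -/
lemma exists_isometry {a b a' b' : Fin 3 → F}
    (haa : herm (RingHom.id F) a a = herm (RingHom.id F) a' a')
    (hab : herm (RingHom.id F) a b = herm (RingHom.id F) a' b')
    (hbb : herm (RingHom.id F) b b = herm (RingHom.id F) b' b')
    (hd : herm (RingHom.id F) a a * herm (RingHom.id F) b b
      - herm (RingHom.id F) a b ^ 2 ≠ 0) :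
    ∃ g ∈ SU (RingHom.id F), g.1.mulVec a = a' ∧ g.1.mulVec b = b' := by
  -- The third column is the cross product of `a` and `b` adapted to the form: it is orthogonal to
  -- both, and its norm and `det M` are both minus the Gram determinant. Hence equal Gram matrices
  -- make `M' M⁻¹` an isometry of determinant one.
  let M (a b : Fin 3 → F) : Matrix (Fin 3) (Fin 3) F :=
    !![a 0, b 0, a 0 * b 1 - a 1 * b 0;
       a 1, b 1, a 2 * b 0 - a 0 * b 2;
       a 2, b 2, a 1 * b 2 - a 2 * b 1]
  have hdet (a b : Fin 3 → F) : (M a b).det = -(herm (RingHom.id F) a a * herm (RingHom.id F) b b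
      - herm (RingHom.id F) a b ^ 2) := by
    simp only [M, Matrix.det_fin_three, herm, RingHom.id_apply]
    simp
    ring
  have hform (a b x y : Fin 3 → F) :
      herm (RingHom.id F) ((M a b).mulVec x) ((M a b).mulVec y) =
        x 0 * y 0 * herm (RingHom.id F) a a + (x 0 * y 1 + x 1 * y 0) * herm (RingHom.id F) a b
        + x 1 * y 1 * herm (RingHom.id F) b b
        - x 2 * y 2 * (herm (RingHom.id F) a a * herm (RingHom.id F) b b
          - herm (RingHom.id F) a b ^ 2) := by
    simp [M, herm, Matrix.mulVec, dotProduct, Fin.sum_univ_three]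
    ring
  have hM0 (a b : Fin 3 → F) : (M a b).mulVec (Pi.single 0 1) = a := by
    funext i
    fin_cases i <;> simp [M]
  have hM1 (a b : Fin 3 → F) : (M a b).mulVec (Pi.single 1 1) = b := by
    funext i
    fin_cases i <;> simp [M]
  have hu : IsUnit (M a b).det := by
    rw [hdet, isUnit_iff_ne_zero]
    exact neg_ne_zero.2 hd
  have hdd : (M a' b').det = (M a b).det := by rw [hdet, hdet, haa, hab, hbb]
  have hg (x : Fin 3 → F) : (M a' b' * (M a b)⁻¹).mulVec ((M a b).mulVec x)
      = (M a' b').mulVec x := by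
    rw [Matrix.mulVec_mulVec, Matrix.mul_assoc, Matrix.nonsing_inv_mul _ hu, Matrix.mul_one]
  refine ⟨⟨M a' b' * (M a b)⁻¹, ?_⟩, ?_, ?_, ?_⟩
  · rw [Matrix.det_mul, hdd, ← Matrix.det_mul, Matrix.mul_nonsing_inv _ hu, Matrix.det_one]
  · intro x y
    obtain ⟨x, rfl⟩ : ∃ z, (M a b).mulVec z = x :=
      ⟨(M a b)⁻¹.mulVec x, by rw [Matrix.mulVec_mulVec, Matrix.mul_nonsing_inv _ hu,
        Matrix.one_mulVec]⟩
    obtain ⟨y, rfl⟩ : ∃ z, (M a b).mulVec z = y :=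
      ⟨(M a b)⁻¹.mulVec y, by rw [Matrix.mulVec_mulVec, Matrix.mul_nonsing_inv _ hu,
        Matrix.one_mulVec]⟩
    rw [hg, hg, hform, hform, haa, hab, hbb]
  · have := hg (Pi.single 0 1)
    rwa [hM0, hM0] at this
  · have := hg (Pi.single 1 1)
    rwa [hM1, hM1] at this

/-- The lower unipotent isometries of the split quadratic space of dimension three. -/
lemma exists_isometry_lower (h2 : (2 : F) ≠ 0) (y : F) :
    ∃ g ∈ SU (RingHom.id F), g.1.mulVec (Pi.single 0 1) = ![1, y, -y ^ 2 / 2] := by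
  refine ⟨⟨!![1, 0, 0; y, 1, 0; -y ^ 2 / 2, -y, 1], ?_⟩, ?_, ?_⟩
  · simp [Matrix.det_fin_three]
  · intro x z
    simp [herm, Matrix.mulVec, dotProduct, Fin.sum_univ_three]
    field_simp
    ring
  · funext i
    fin_cases i <;> simp

/-- The images of `e₀` in `exists_isometry_lower` are the points of the conic in an affine chart;
this supplies the one point at infinity. -/
lemma exists_isometry_swap :
    ∃ g ∈ SU (RingHom.id F), g.1.mulVec (Pi.single 0 1) = ![0, 0, -1] := by
  refine ⟨⟨!![0, 0, -1; 0, -1, 0; -1, 0, 0], ?_⟩, ?_, ?_⟩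
  · simp [Matrix.det_fin_three]
  · intro x z
    simp [herm, Matrix.mulVec, dotProduct, Fin.sum_univ_three]
    ring
  · funext i
    fin_cases i <;> simp

end Isometry

/-! ### Isotropic vectors over a quadratic extension of a finite field -/

/-- `k` is the quadratic extension `F(ε)` of `F`, with `ε² = d` not a square in `F`, and `σ` is its
conjugation. -/
structure IsQuadratic (F : Type*) {k : Type*} [Field F] [Field k] [Algebra F k] (σ : k →+* k)
    (ε : k) (d : F) : Prop where
  two_ne : (2 : F) ≠ 0
  sq : ε ^ 2 = algebraMap F k d
  not_isSquare : ¬ IsSquare d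
  exists_eq : ∀ x : k, ∃ a b : F, x = algebraMap F k a + algebraMap F k b * ε
  conj_algebraMap : ∀ a : F, σ (algebraMap F k a) = algebraMap F k a
  conj_eps : σ ε = -ε

namespace IsQuadratic

variable {F k : Type*} [Field F] [Field k] [Algebra F k] {σ : k →+* k} {ε : k} {d : F}

lemma eq_zero (H : IsQuadratic F σ ε d) {a b : F}
    (h : algebraMap F k a + algebraMap F k b * ε = 0) : a = 0 ∧ b = 0 := by
  have hb : b = 0 := by
    by_contra hb
    have h1 : ε = algebraMap F k (-a / b) := by
      have : algebraMap F k b ≠ 0 := (map_ne_zero _).2 hb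
      rw [map_div₀, map_neg]
      field_simp
      linear_combination h
    refine H.not_isSquare ⟨-a / b, (algebraMap F k).injective ?_⟩
    rw [← H.sq, h1, map_mul, pow_two]
  subst hb
  simpa using h

lemma ext (H : IsQuadratic F σ ε d) {a b a' b' : F}
    (h : algebraMap F k a + algebraMap F k b * ε = algebraMap F k a' + algebraMap F k b' * ε) :
    a = a' ∧ b = b' := by
  have := H.eq_zero (a := a - a') (b := b - b') (by
    rw [map_sub, map_sub]
    linear_combination h)
  exact ⟨sub_eq_zero.1 this.1, sub_eq_zero.1 this.2⟩

lemma eps_ne (H : IsQuadratic F σ ε d) : ε ≠ 0 := by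
  intro h
  have := H.eq_zero (a := 0) (b := 1) (by simp [h])
  exact one_ne_zero (α := F) this.2

lemma algebraMap_two : algebraMap F k 2 = 2 := map_ofNat _ 2

lemma two_ne' (H : IsQuadratic F σ ε d) : (2 : k) ≠ 0 := by
  have := (map_ne_zero (algebraMap F k)).2 H.two_ne
  rwa [map_ofNat] at this

lemma d_ne (H : IsQuadratic F σ ε d) : d ≠ 0 := by
  rintro rfl
  exact H.not_isSquare IsSquare.zero

lemma finite [Finite F] (H : IsQuadratic F σ ε d) : Finite k :=
  Finite.of_surjective (fun p : F × F => algebraMap F k p.1 + algebraMap F k p.2 * ε)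
    fun x => by
      obtain ⟨a, b, h⟩ := H.exists_eq x
      exact ⟨(a, b), h.symm⟩

lemma eq_algebraMap_of_conj (H : IsQuadratic F σ ε d) {x : k} (h : σ x = x) :
    ∃ a, x = algebraMap F k a := by
  obtain ⟨a, b, rfl⟩ := H.exists_eq x
  rw [map_add, map_mul, H.conj_algebraMap, H.conj_algebraMap, H.conj_eps] at h
  have h1 : algebraMap F k b * ε = 0 := by
    have h3 : 2 * (algebraMap F k b * ε) = 0 := by linear_combination -h
    exact (mul_eq_zero.1 h3).resolve_left H.two_ne'
  exact ⟨a, by rw [h1, add_zero]⟩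

end IsQuadratic

/-- In a finite field the product of two non-squares is a square. -/
lemma isSquare_mul_of_not_isSquare {k : Type*} [Field k] [Finite k] (h2 : (2 : k) ≠ 0) {x y : k}
    (hx : ¬ IsSquare x) (hy : ¬ IsSquare y) : IsSquare (x * y) := by
  classical
  have := Fintype.ofFinite k
  have hc : ringChar k ≠ 2 := by
    intro h
    exact h2 (by simpa [h] using ringChar.Nat.cast_ringChar (R := k))
  have hx0 : x ≠ 0 := fun h => hx (h ▸ IsSquare.zero)
  have hy0 : y ≠ 0 := fun h => hy (h ▸ IsSquare.zero)
  rw [← quadraticChar_one_iff_isSquare (mul_ne_zero hx0 hy0), map_mul,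
    quadraticChar_neg_one_iff_not_isSquare.2 hx, quadraticChar_neg_one_iff_not_isSquare.2 hy]
  rfl

namespace IsQuadratic

variable {F k : Type*} [Field F] [Field k] [Algebra F k] {σ : k →+* k} {ε : k} {d : F}

lemma isSquare_algebraMap [Finite F] (H : IsQuadratic F σ ε d) (a : F) :
    IsSquare (algebraMap F k a) := by
  by_cases ha : IsSquare a
  · exact ha.map _
  -- If `a` is not a square in `F`, then `ad = y²`, so `a = (y/ε)²`.
  · obtain ⟨y, hy⟩ := isSquare_mul_of_not_isSquare H.two_ne ha H.not_isSquare
    refine ⟨algebraMap F k y / ε, ?_⟩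
    have h := congrArg (algebraMap F k) hy
    rw [map_mul, map_mul, ← H.sq] at h
    have := H.eps_ne
    field_simp
    linear_combination h

/-- Every square class contains the value of the quadratic form at a hermitian isotropic vector. -/
lemma exists_isotropic [Finite F] (H : IsQuadratic F σ ε d) {β : k} (hβ : β ≠ 0) :
    ∃ v : Fin 3 → k, v ≠ 0 ∧ herm σ v v = 0 ∧ herm (RingHom.id k) v v ≠ 0 ∧
      IsSquare (herm (RingHom.id k) v v * β) := by
  have h2 := H.two_ne'
  have hε := H.eps_ne
  have hd : algebraMap F k d ≠ 0 := (map_ne_zero _).2 H.d_ne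
  obtain ⟨s, m, rfl⟩ := H.exists_eq β
  -- Both witnesses have `q(v)` equal to `β` times an element of `F`, which is a square in `k`: the
  -- factor is `2` for `s = 0` and `2d/s` otherwise. The coordinate `d/2` makes the hermitian trace
  -- cancel `εσ(ε) = -d`.
  by_cases hs : s = 0
  · subst hs
    rw [map_zero, zero_add] at hβ ⊢
    refine ⟨![1, 0, algebraMap F k m * ε], fun h => ?_, ?_, ?_, ?_⟩
    · simpa using congrFun h 0
    · simp [herm, H.conj_algebraMap, H.conj_eps]
    · have : herm (RingHom.id k) ![1, 0, algebraMap F k m * ε] ![1, 0, algebraMap F k m * ε]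
          = 2 * (algebraMap F k m * ε) := by
        simp [herm]
        ring
      rw [this]
      exact mul_ne_zero h2 hβ
    · obtain ⟨r, hr⟩ := H.isSquare_algebraMap 2
      refine ⟨r * (algebraMap F k m * ε), ?_⟩
      rw [map_ofNat] at hr
      simp [herm]
      linear_combination (algebraMap F k m * ε) ^ 2 * hr
  · have hs' : algebraMap F k s ≠ 0 := (map_ne_zero _).2 hs
    have key : herm (RingHom.id k)
        ![1, ε, algebraMap F k (d / 2) + algebraMap F k (d * m / s) * ε]
        ![1, ε, algebraMap F k (d / 2) + algebraMap F k (d * m / s) * ε]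
          = algebraMap F k (2 * d / s) * (algebraMap F k s + algebraMap F k m * ε) := by
      simp [herm, algebraMap_two]
      field_simp
      linear_combination (2 * algebraMap F k s) * H.sq
    refine ⟨![1, ε, algebraMap F k (d / 2) + algebraMap F k (d * m / s) * ε], fun h => ?_, ?_, ?_,
      ?_⟩
    · simpa using congrFun h 0
    · simp [herm, H.conj_algebraMap, H.conj_eps, algebraMap_two, map_ofNat σ 2]
      field_simp
      linear_combination -2 * algebraMap F k s * H.sq
    · rw [key]
      refine mul_ne_zero ?_ hβ
      simpa using ⟨⟨H.two_ne, H.d_ne⟩, hs⟩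
    · rw [key, mul_assoc]
      exact (H.isSquare_algebraMap _).mul ⟨_, rfl⟩

lemma herm_map (g : k →+* k) {R : Type*} [CommRing R] (f : R →+* k) (s : R →+* R)
    (h : ∀ x, g (f x) = f (s x)) (a b : Fin 3 → R) :
    herm g (f ∘ a) (f ∘ b) = f (herm s a b) := by
  simp [herm, h]

/-- The image of an isometry over `F` acts on `k³`. -/
lemma mulVec_map (g : Matrix (Fin 3) (Fin 3) F) (a : Fin 3 → F) :
    (g.map (algebraMap F k)).mulVec (algebraMap F k ∘ a) = algebraMap F k ∘ g.mulVec a := by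
  funext i
  exact ((algebraMap F k).map_mulVec g a i).symm

lemma exists_eq_add_smul (H : IsQuadratic F σ ε d) (v : Fin 3 → k) :
    ∃ a b : Fin 3 → F, v = (algebraMap F k ∘ a) + ε • (algebraMap F k ∘ b) := by
  choose a b h using fun i => H.exists_eq (v i)
  exact ⟨a, b, funext fun i => by simp [h i, mul_comm]⟩

/-- Together with `form_self`, this shows that the hermitian and quadratic values at `a + εb`
determine the Gram matrix of `(a, b)`: they give the difference and the sum of `q(a)` and `d q(b)`,
and twice the pairing. -/
lemma herm_self (H : IsQuadratic F σ ε d) (a b : Fin 3 → F) :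
    herm σ ((algebraMap F k ∘ a) + ε • (algebraMap F k ∘ b))
      ((algebraMap F k ∘ a) + ε • (algebraMap F k ∘ b)) =
    algebraMap F k (herm (RingHom.id F) a a - d * herm (RingHom.id F) b b) := by
  simp [herm, H.conj_algebraMap, H.conj_eps, ← H.sq]
  ring

lemma form_self (H : IsQuadratic F σ ε d) (a b : Fin 3 → F) :
    herm (RingHom.id k) ((algebraMap F k ∘ a) + ε • (algebraMap F k ∘ b))
      ((algebraMap F k ∘ a) + ε • (algebraMap F k ∘ b)) =
    algebraMap F k (herm (RingHom.id F) a a + d * herm (RingHom.id F) b b) +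
      algebraMap F k (2 * herm (RingHom.id F) a b) * ε := by
  simp [herm, ← H.sq, algebraMap_two]
  ring

/-- A vector that is isotropic for the hermitian and for the quadratic form is proportional to the
image of `e₀` under an isometry over `F`. -/
lemma exists_isometry_of_form_eq_zero (H : IsQuadratic F σ ε d) {v : Fin 3 → k} (hv : v ≠ 0)
    (h1 : herm σ v v = 0) (h2 : herm (RingHom.id k) v v = 0) :
    ∃ g ∈ SU (RingHom.id F), ∃ u : k, u ≠ 0 ∧
      v = u • (g.1.map (algebraMap F k)).mulVec (algebraMap F k ∘ Pi.single 0 1) := by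
  have h20 := H.two_ne'
  simp only [herm, RingHom.id_apply] at h1 h2
  by_cases hv0 : v 0 = 0
  · have hv1 : v 1 = 0 := by
      rw [hv0] at h2
      simpa using h2
    have hv2 : v 2 ≠ 0 := by
      intro hv2
      refine hv (funext fun i => ?_)
      fin_cases i <;> simp [hv0, hv1, hv2]
    obtain ⟨g, hg, hg'⟩ := exists_isometry_swap (F := F)
    refine ⟨g, hg, -v 2, neg_ne_zero.2 hv2, ?_⟩
    rw [mulVec_map, hg']
    funext i
    fin_cases i <;> simp [hv0, hv1]
  · have hsv0 : σ (v 0) ≠ 0 := (map_ne_zero σ).2 hv0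
    -- The vectors `v` and `σ(v)` span a totally isotropic space for `q`, and such spaces have
    -- dimension at most one. The combination below is the square of the minor `v₀σ(v₁) - v₁σ(v₀)`.
    have hfix : σ (v 1 / v 0) = v 1 / v 0 := by
      have h3 := congrArg σ h2
      simp only [map_add, map_mul, map_zero] at h3
      rw [map_div₀, div_eq_div_iff hsv0 hv0, ← sub_eq_zero]
      refine pow_eq_zero_iff (two_ne_zero) |>.1 ?_
      linear_combination v 0 ^ 2 * h3 + (σ (v 0)) ^ 2 * h2 - 2 * v 0 * σ (v 0) * h1
    obtain ⟨y, hy⟩ := H.eq_algebraMap_of_conj hfix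
    obtain ⟨g, hg, hg'⟩ := exists_isometry_lower H.two_ne y
    refine ⟨g, hg, v 0, hv0, ?_⟩
    rw [mulVec_map, hg']
    have hy' : v 1 = v 0 * algebraMap F k y := by
      rw [← hy]
      field_simp
    funext i
    fin_cases i
    · simp
    · simpa using hy'
    · simp [algebraMap_two]
      field_simp
      refine mul_left_cancel₀ hv0 ?_
      rw [hy'] at h2
      linear_combination h2

/-- Hermitian isotropic vectors at which the quadratic form has values in the same square class are
proportional up to an isometry over `F`. -/
lemma exists_isometry_of_form (H : IsQuadratic F σ ε d) {v v' : Fin 3 → k}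
    (hv : v ≠ 0) (hv' : v' ≠ 0) (h1 : herm σ v v = 0) (h1' : herm σ v' v' = 0)
    (h : herm (RingHom.id k) v v = 0 ↔ herm (RingHom.id k) v' v' = 0)
    (hsq : IsSquare (herm (RingHom.id k) v v * herm (RingHom.id k) v' v')) :
    ∃ g ∈ SU (RingHom.id F), ∃ u : k, u ≠ 0 ∧
      (g.1.map (algebraMap F k)).mulVec v = u • v' := by
  by_cases h0 : herm (RingHom.id k) v v = 0
  · obtain ⟨g, hg, u, hu, e⟩ := H.exists_isometry_of_form_eq_zero hv h1 h0
    obtain ⟨g', hg', u', hu', e'⟩ := H.exists_isometry_of_form_eq_zero hv' h1' (h.1 h0)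
    refine ⟨g' * g⁻¹, mul_mem hg' (inv_mem hg), u / u', div_ne_zero hu hu', ?_⟩
    rw [e, e', Matrix.mulVec_smul, smul_smul, div_mul_cancel₀ _ hu', mulVec_map, mulVec_map,
      mulVec_map, Matrix.SpecialLinearGroup.coe_mul, ← Matrix.mulVec_mulVec]
    have := matAct_inv_cancel g⁻¹ (Pi.single 0 1)
    rw [inv_inv] at this
    rw [this]
  · have h0' : herm (RingHom.id k) v' v' ≠ 0 := fun h' => h0 (h.2 h')
    obtain ⟨r, hr⟩ := hsq
    -- Rescaling `v'` by `c` makes the two values of the quadratic form equal, not just equal up to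
    -- squares.
    set c : k := r / herm (RingHom.id k) v' v' with hc
    have hcc : c ^ 2 * herm (RingHom.id k) v' v' = herm (RingHom.id k) v v := by
      rw [hc]
      field_simp
      linear_combination -hr
    have hc0 : c ≠ 0 := by
      intro hc0
      rw [hc0] at hcc
      exact h0 (by simpa using hcc.symm)
    obtain ⟨a, b, e⟩ := H.exists_eq_add_smul v
    obtain ⟨a', b', e'⟩ := H.exists_eq_add_smul (c • v')
    have e1 : herm σ (c • v') (c • v') = 0 := by
      have : herm σ (c • v') (c • v') = c * σ c * herm σ v' v' := by
        simp [herm]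
        ring
      rw [this, h1', mul_zero]
    have e2 : herm (RingHom.id k) (c • v') (c • v') = herm (RingHom.id k) v v := by
      rw [← hcc]
      simp [herm]
      ring
    rw [e, e', H.form_self, H.form_self] at e2
    rw [e', H.herm_self, map_eq_zero] at e1
    rw [e, H.herm_self, map_eq_zero] at h1
    rw [e, H.form_self] at h0
    obtain ⟨e3, e4⟩ := H.ext e2
    have hd2 : (2 * d) ≠ 0 := mul_ne_zero H.two_ne H.d_ne
    have hbb : herm (RingHom.id F) b b = herm (RingHom.id F) b' b' :=
      mul_left_cancel₀ hd2 (by linear_combination -e3 - h1 + e1)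
    have hab : herm (RingHom.id F) a b = herm (RingHom.id F) a' b' :=
      mul_left_cancel₀ H.two_ne e4.symm
    have haa : herm (RingHom.id F) a a = herm (RingHom.id F) a' a' := by
      linear_combination h1 - e1 + d * hbb
    -- Since `q(a) = d q(b)`, the Gram determinant is `d q(b)² - h(a, b)²`. Its vanishing would make
    -- `d` a square, or make the whole Gram matrix and so `q(v)` zero.
    obtain ⟨g, hg, ga, gb⟩ := exists_isometry haa hab hbb (by
      intro hz
      by_cases hn : herm (RingHom.id F) b b = 0
      · have hm : herm (RingHom.id F) a b = 0 := by
          rw [hn] at hz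
          simpa using hz
        have ha : herm (RingHom.id F) a a = 0 := by
          rw [hn] at h1
          simpa using h1
        exact h0 (by simp [hn, hm, ha])
      · refine H.not_isSquare ⟨herm (RingHom.id F) a b / herm (RingHom.id F) b b, ?_⟩
        field_simp
        linear_combination hz - herm (RingHom.id F) b b * h1)
    refine ⟨g, hg, c, hc0, ?_⟩
    rw [e', e, Matrix.mulVec_add, Matrix.mulVec_smul, mulVec_map, mulVec_map, ga, gb]

end IsQuadratic

section Herm

variable {E : Type*} [CommRing E] (σ : E →+* E)

lemma herm_add_left (x x' y : Fin 3 → E) : herm σ (x + x') y = herm σ x y + herm σ x' y := by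
  simp [herm]
  ring

lemma herm_add_right (x y y' : Fin 3 → E) : herm σ x (y + y') = herm σ x y + herm σ x y' := by
  simp [herm]
  ring

lemma herm_smul_left (c : E) (x y : Fin 3 → E) : herm σ (c • x) y = c * herm σ x y := by
  simp [herm]
  ring

lemma herm_smul_right (c : E) (x y : Fin 3 → E) : herm σ x (c • y) = σ c * herm σ x y := by
  simp [herm]
  ring

lemma herm_single_left (i : Fin 3) (y : Fin 3 → E) : herm σ (Pi.single i 1) y = σ (y i.rev) := by
  fin_cases i <;> simp [herm]

lemma herm_single_right (x : Fin 3 → E) (i : Fin 3) : herm σ x (Pi.single i 1) = x i.rev := by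
  fin_cases i <;> simp [herm]

lemma herm_eq_sum (x y : Fin 3 → E) : herm σ x y = ∑ i, x i * σ (y i.rev) := by
  rw [Fin.sum_univ_three]
  rfl

variable {σ}

lemma conj_herm (h : ∀ x, σ (σ x) = x) (x y : Fin 3 → E) : σ (herm σ x y) = herm σ y x := by
  simp [herm, h]
  ring

end Herm

/-! ### Lattices and homothety over a discrete valuation ring -/

/-- `O` is a discrete valuation ring with fraction field `E` and uniformizer `ϖ`, stable under the
involution `σ` of `E`, which fixes `ϖ`. -/
structure IsLocalDatum {E : Type*} [CommRing E] (O : Subring E) (σ : E →+* E) (ϖ : Eˣ) : Prop where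
  unif_mem : (ϖ : E) ∈ O
  inv_not_mem : ((ϖ⁻¹ : Eˣ) : E) ∉ O
  exists_eq : ∀ x : E, x ≠ 0 → ∃ n : ℤ, ∃ u : Oˣ, x = ((ϖ ^ n : Eˣ) : E) * (u : O)
  conj_unif : σ ϖ = ϖ
  conj_conj : ∀ x, σ (σ x) = x
  conj_mem : ∀ x ∈ O, σ x ∈ O

section Lattices

variable {E : Type*} [CommRing E] {O : Subring E} {σ : E →+* E} {ϖ : Eˣ}

lemma mem_units_smul (c : Eˣ) (N : Submodule O (Fin 3 → E)) (x : Fin 3 → E) :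
    x ∈ c • N ↔ c⁻¹ • x ∈ N := by
  change x ∈ (c : E) • N ↔ _
  rw [Submodule.mem_smul_pointwise_iff_exists]
  change (∃ y ∈ N, c • y = x) ↔ _
  constructor
  · rintro ⟨y, hy, rfl⟩
    rwa [inv_smul_smul]
  · exact fun h => ⟨_, h, smul_inv_smul c x⟩

lemma single_mem_std (i : Fin 3) : (Pi.single i 1 : Fin 3 → E) ∈ stdSubmodule O := by
  rw [stdSubmodule_eq_span]
  exact Submodule.subset_span ⟨i, rfl⟩

lemma cls_eq_iff {Λ Λ' : Lattice O} : Λ.cls = Λ'.cls ↔ ∃ c : Eˣ, c • Λ' = Λ :=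
  Quotient.eq (r := MulAction.orbitRel Eˣ (Lattice O))

namespace IsLocalDatum

variable (H : IsLocalDatum O σ ϖ)
include H

lemma nontrivial : Nontrivial E :=
  ⟨⟨((ϖ⁻¹ : Eˣ) : E), 0, fun h => H.inv_not_mem (h ▸ O.zero_mem)⟩⟩

lemma pow_mem {n : ℤ} (hn : 0 ≤ n) : ((ϖ ^ n : Eˣ) : E) ∈ O := by
  lift n to ℕ using hn
  simpa using O.pow_mem H.unif_mem n

lemma nonneg_of_mem {n : ℤ} (h : ((ϖ ^ n : Eˣ) : E) ∈ O) : 0 ≤ n := by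
  by_contra hn
  refine H.inv_not_mem ?_
  have h1 : ϖ⁻¹ = ϖ ^ n * ϖ ^ (-n - 1) := by
    rw [← zpow_add, ← zpow_neg_one]
    congr 1
    ring
  rw [h1, Units.val_mul]
  exact O.mul_mem h (H.pow_mem (by omega))

/-- The exponent of `x` is pinned to zero: `x ∈ O` makes it nonnegative, and `ϖ⁻¹x ∉ O` makes it
less than one. -/
lemma exists_inv {x : E} (hx : x ∈ O) (h : ((ϖ⁻¹ : Eˣ) : E) * x ∉ O) : ∃ y ∈ O, x * y = 1 := by
  obtain ⟨n, u, hu⟩ := H.exists_eq x (by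
    rintro rfl
    rw [mul_zero] at h
    exact h O.zero_mem)
  have hn : 0 ≤ n := by
    refine H.nonneg_of_mem ?_
    have : ((ϖ ^ n : Eˣ) : E) = x * ((u⁻¹ : Oˣ) : O) := by
      rw [hu, mul_assoc, ← Subring.coe_mul, Units.mul_inv, Subring.coe_one, mul_one]
    rw [this]
    exact O.mul_mem hx (SetLike.coe_mem _)
  have hn' : ¬ 0 ≤ n - 1 := by
    intro h1
    refine h ?_
    rw [hu, ← mul_assoc, ← Units.val_mul, ← zpow_neg_one, ← zpow_add]
    exact O.mul_mem (H.pow_mem (by omega)) (SetLike.coe_mem _)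
  obtain rfl : n = 0 := by omega
  refine ⟨((u⁻¹ : Oˣ) : O), SetLike.coe_mem _, ?_⟩
  rw [hu, zpow_zero, Units.val_one, one_mul, ← Subring.coe_mul, Units.mul_inv, Subring.coe_one]

lemma ne_unif_mul {y : E} (hy : y ∈ O) : (ϖ : E) * y ≠ 1 := by
  intro h
  refine H.inv_not_mem ?_
  rwa [← Units.eq_inv_of_mul_eq_one_left h]

lemma smul_le_smul {m n : ℤ} (h : m ≤ n) (N : Submodule O (Fin 3 → E)) :
    ϖ ^ n • N ≤ ϖ ^ m • N := by
  intro x hx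
  rw [mem_units_smul] at hx ⊢
  have h1 : (ϖ ^ m)⁻¹ • x =
      (⟨((ϖ ^ (n - m) : Eˣ) : E), H.pow_mem (by omega)⟩ : O) • (ϖ ^ n)⁻¹ • x := by
    rw [Subring.smul_def]
    change _ = (ϖ ^ (n - m)) • (ϖ ^ n)⁻¹ • x
    rw [smul_smul, ← zpow_neg, ← zpow_neg, ← zpow_add]
    congr 2
    ring
  rw [h1]
  exact N.smul_mem _ hx

/-- Units of `O` map every lattice onto itself, so only the valuation of the homothety ratio
matters. -/
lemma exists_zpow_smul {Λ Λ' : Lattice O} (h : Λ.cls = Λ'.cls) : ∃ n : ℤ, Λ.1 = ϖ ^ n • Λ'.1 := by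
  have := H.nontrivial
  obtain ⟨c, rfl⟩ := cls_eq_iff.1 h
  obtain ⟨n, u, hu⟩ := H.exists_eq c c.ne_zero
  refine ⟨n, ?_⟩
  have hc : c = ϖ ^ n * Units.map O.subtype.toMonoidHom u := Units.ext hu
  rw [coe_units_smul, hc, mul_smul]
  congr 1
  ext x
  rw [mem_units_smul]
  constructor
  · intro hx
    have h2 := Λ'.1.smul_mem (u : O) hx
    rw [Subring.smul_def] at h2
    change (Units.map O.subtype.toMonoidHom u) • (Units.map O.subtype.toMonoidHom u)⁻¹ • x ∈ _ at h2
    rwa [smul_inv_smul] at h2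
  · intro hx
    exact Λ'.1.smul_mem ((u⁻¹ : Oˣ) : O) hx

/-- A unimodular lattice homothetic to `O³` is `O³`. -/
lemma eq_std_of_unimodular {M : Lattice O} (hM : IsDual σ M M) (h : M.cls = (stdLattice O).cls) :
    M.1 = stdSubmodule O := by
  obtain ⟨n, hn⟩ := H.exists_zpow_smul h
  change M.1 = ϖ ^ n • stdSubmodule O at hn
  have hσ (n : ℤ) : σ ((ϖ ^ n : Eˣ) : E) = ((ϖ ^ n : Eˣ) : E) := by
    have h1 : Units.map σ.toMonoidHom ϖ = ϖ := Units.ext H.conj_unif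
    have h2 : Units.map σ.toMonoidHom (ϖ ^ n) = ϖ ^ n := by rw [map_zpow, h1]
    exact congrArg Units.val h2
  have hmem (i : Fin 3) : ((ϖ ^ n : Eˣ) : E) • (Pi.single i 1 : Fin 3 → E) ∈ M.1 := by
    rw [hn, mem_units_smul]
    change (ϖ ^ n)⁻¹ • (ϖ ^ n) • (Pi.single i 1 : Fin 3 → E) ∈ _
    rw [inv_smul_smul]
    exact single_mem_std i
  -- For `M = ϖⁿO³`, the inclusion of `M` in its dual gives `2n ≥ 0`, and the reverse inclusion
  -- gives `-2n ≥ 0`.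
  have h1 : 0 ≤ n + n := by
    have h2 : ((ϖ ^ n : Eˣ) : E) • (Pi.single 0 1 : Fin 3 → E) ∈ dual σ M.1 :=
      hM ▸ hmem 0
    have h3 := h2 _ (hmem 2)
    rw [herm_smul_left, herm_smul_right, herm_single_right, hσ] at h3
    refine H.nonneg_of_mem ?_
    rw [zpow_add, Units.val_mul]
    simpa using h3
  have h2 : 0 ≤ -n + -n := by
    have h2 : ((ϖ ^ (-n) : Eˣ) : E) • (Pi.single 0 1 : Fin 3 → E) ∈ M.1 := by
      change _ ∈ (M.1 : Set (Fin 3 → E))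
      rw [hM]
      intro y hy
      rw [hn, mem_units_smul, ← zpow_neg] at hy
      have h4 := H.conj_mem _ (hy 2)
      change σ (((ϖ ^ (-n) : Eˣ) : E) * y 2) ∈ O at h4
      rw [map_mul, hσ] at h4
      rw [herm_smul_left, herm_single_left]
      exact h4
    rw [hn, mem_units_smul, ← zpow_neg] at h2
    refine H.nonneg_of_mem ?_
    rw [zpow_add, Units.val_mul]
    have := h2 0
    change ((ϖ ^ (-n) : Eˣ) : E) * _ ∈ O at this
    simpa using this
  obtain rfl : n = 0 := by omega
  rw [hn, zpow_zero, one_smul]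

end IsLocalDatum

/-! ### The lattices between `ϖO³` and `O³`, and between `O³` and `ϖ⁻¹O³` -/

/-- The lattice of the `x` in `O³` with `h(x, w)` divisible by `ϖ`. -/
def planeLattice (O : Subring E) (σ : E →+* E) (ϖ : Eˣ) (w : Fin 3 → E) :
    Submodule O (Fin 3 → E) where
  carrier := {x | x ∈ stdSubmodule O ∧ ((ϖ⁻¹ : Eˣ) : E) * herm σ x w ∈ O}
  add_mem' hx hy := ⟨add_mem hx.1 hy.1, by
    rw [herm_add_left, mul_add]
    exact O.add_mem hx.2 hy.2⟩
  zero_mem' := ⟨zero_mem _, by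
    simp [herm, O.zero_mem]⟩
  smul_mem' c x hx := ⟨Submodule.smul_mem _ c hx.1, by
    rw [Subring.smul_def, herm_smul_left, mul_left_comm]
    exact O.mul_mem c.2 hx.2⟩

/-- The lattice `O³ + ϖ⁻¹Ow`. -/
def lineLattice (O : Subring E) (ϖ : Eˣ) (w : Fin 3 → E) : Submodule O (Fin 3 → E) :=
  stdSubmodule O ⊔ Submodule.span O {ϖ⁻¹ • w}

lemma mem_planeLattice {w x : Fin 3 → E} : x ∈ planeLattice O σ ϖ w ↔
    x ∈ stdSubmodule O ∧ ((ϖ⁻¹ : Eˣ) : E) * herm σ x w ∈ O := Iff.rfl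

lemma mem_lineLattice {w x : Fin 3 → E} : x ∈ lineLattice O ϖ w ↔
    ∃ m ∈ stdSubmodule O, ∃ c ∈ O, x = m + c • ϖ⁻¹ • w := by
  rw [lineLattice, Submodule.mem_sup]
  simp only [Submodule.mem_span_singleton]
  constructor
  · rintro ⟨m, hm, _, ⟨c, rfl⟩, rfl⟩
    exact ⟨m, hm, c, c.2, rfl⟩
  · rintro ⟨m, hm, c, hc, rfl⟩
    exact ⟨m, hm, _, ⟨⟨c, hc⟩, rfl⟩, rfl⟩

/-- The vector `w` has integral coordinates, not all divisible by `ϖ`. -/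
def IsPrimitive (O : Subring E) (ϖ : Eˣ) (w : Fin 3 → E) : Prop :=
  w ∈ stdSubmodule O ∧ ∃ j, ((ϖ⁻¹ : Eˣ) : E) * w j ∉ O

namespace IsLocalDatum

variable (H : IsLocalDatum O σ ϖ)
include H

lemma conj_inv : σ ((ϖ⁻¹ : Eˣ) : E) = ((ϖ⁻¹ : Eˣ) : E) := by
  have h1 : Units.map σ.toMonoidHom ϖ = ϖ := Units.ext H.conj_unif
  have h2 : Units.map σ.toMonoidHom ϖ⁻¹ = ϖ⁻¹ := by rw [map_inv, h1]
  exact congrArg Units.val h2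

lemma herm_mem {x y : Fin 3 → E} (hx : x ∈ stdSubmodule O) (hy : y ∈ stdSubmodule O) :
    herm σ x y ∈ O :=
  O.add_mem (O.add_mem (O.mul_mem (hx 0) (H.conj_mem _ (hy 2)))
    (O.mul_mem (hx 1) (H.conj_mem _ (hy 1)))) (O.mul_mem (hx 2) (H.conj_mem _ (hy 0)))

/-- A primitive vector has a coordinate that is invertible in `O`. -/
lemma exists_coord {w : Fin 3 → E} (hw : IsPrimitive O ϖ w) :
    ∃ j : Fin 3, ∃ t ∈ O, t * σ (w j.rev) = 1 := by
  obtain ⟨j, hj⟩ := hw.2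
  obtain ⟨y, hy, h⟩ := H.exists_inv (hw.1 j) hj
  refine ⟨j.rev, σ y, H.conj_mem y hy, ?_⟩
  rw [Fin.rev_rev, ← map_mul, mul_comm, h, map_one]

lemma unif_smul_mem_plane {w x : Fin 3 → E} (hw : w ∈ stdSubmodule O) (hx : x ∈ stdSubmodule O) :
    (ϖ : E) • x ∈ planeLattice O σ ϖ w := by
  refine ⟨fun i => O.mul_mem H.unif_mem (hx i), ?_⟩
  rw [herm_smul_left, Units.inv_mul_cancel_left]
  exact H.herm_mem hx hw

/-- Test vectors exactly orthogonal to `w`: each `eᵢ` is corrected along the `eⱼ` whose pairing with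
`w` is a unit. -/
lemma sub_mem_plane {w : Fin 3 → E} (hw : w ∈ stdSubmodule O) {j : Fin 3} {t : E} (ht : t ∈ O)
    (h : t * σ (w j.rev) = 1) (i : Fin 3) :
    (Pi.single i 1 - (t * σ (w i.rev)) • Pi.single j 1 : Fin 3 → E) ∈ planeLattice O σ ϖ w := by
  refine ⟨sub_mem (single_mem_std i) fun l => O.mul_mem (O.mul_mem ht (H.conj_mem _ (hw _)))
    (single_mem_std j l), ?_⟩
  have : herm σ (Pi.single i 1 - (t * σ (w i.rev)) • Pi.single j 1 : Fin 3 → E) w = 0 := by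
    rw [sub_eq_add_neg, ← neg_smul, herm_add_left, herm_smul_left, herm_single_left,
      herm_single_left]
    linear_combination -σ (w i.rev) * h
  rw [this, mul_zero]
  exact O.zero_mem

lemma isLattice_plane {w : Fin 3 → E} (hw : IsPrimitive O ϖ w) :
    (planeLattice O σ ϖ w).IsLattice E where
  fg := by
    obtain ⟨j, t, ht, h⟩ := H.exists_coord hw
    -- `T` is the identity on the orthogonal of `w` and multiplies `eⱼ` by `ϖ`, so `h(Tx, w) = ϖ
    -- h(x, w)`. The plane is its image of `O³`, hence finitely generated.
    let T : (Fin 3 → E) →ₗ[O] (Fin 3 → E) :=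
      { toFun := fun x => x - (t * herm σ x w * (1 - ϖ)) • Pi.single j 1
        map_add' := fun x y => by
          rw [herm_add_left]
          module
        map_smul' := fun c x => by
          simp only [Subring.smul_def, RingHom.id_apply]
          rw [herm_smul_left]
          module }
    have hT (x : Fin 3 → E) : T x = x - (t * herm σ x w * (1 - ϖ)) • Pi.single j 1 := rfl
    have hm : planeLattice O σ ϖ w = (stdSubmodule O).map T := by
      refine le_antisymm (fun y hy => ?_) ?_
      · refine ⟨y + (t * (((ϖ⁻¹ : Eˣ) : E) * herm σ y w) * (1 - ϖ)) • Pi.single j 1,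
          add_mem hy.1 fun l => O.mul_mem (O.mul_mem (O.mul_mem ht hy.2)
            (O.sub_mem O.one_mem H.unif_mem)) (single_mem_std j l), ?_⟩
        rw [hT, herm_add_left, herm_smul_left, herm_single_left]
        have h1 : ((ϖ⁻¹ : Eˣ) : E) * ϖ = 1 := ϖ.inv_mul
        have h2 : t * (((ϖ⁻¹ : Eˣ) : E) * herm σ y w) * (1 - ϖ) =
            t * (herm σ y w + t * (((ϖ⁻¹ : Eˣ) : E) * herm σ y w) * (1 - ϖ) * σ (w j.rev))
              * (1 - ϖ) := by
          linear_combination (t * herm σ y w * (1 - ϖ)) * h1 -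
            t * (((ϖ⁻¹ : Eˣ) : E) * herm σ y w) * (1 - ϖ) ^ 2 * h
        rw [← h2, add_sub_cancel_right]
      · rintro _ ⟨x, hx, rfl⟩
        have h1 := H.herm_mem hx hw.1
        refine ⟨sub_mem hx fun l => O.mul_mem (O.mul_mem (O.mul_mem ht h1)
            (O.sub_mem O.one_mem H.unif_mem)) (single_mem_std j l), ?_⟩
        have h2 : herm σ (T x) w = ϖ * herm σ x w := by
          rw [hT, sub_eq_add_neg, ← neg_smul, herm_add_left, herm_smul_left, herm_single_left]
          linear_combination -herm σ x w * (1 - ϖ) * h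
        rw [h2, Units.inv_mul_cancel_left]
        exact h1
    rw [hm]
    exact (stdLattice O).2.fg.map T
  span_eq_top := by
    rw [eq_top_iff, ← (stdLattice O).2.span_eq_top]
    refine Submodule.span_le.2 fun x hx => ?_
    have h1 := Submodule.smul_mem _ ((ϖ⁻¹ : Eˣ) : E)
      (Submodule.subset_span (R := E) (H.unif_smul_mem_plane hw.1 hx))
    rwa [smul_smul, Units.inv_mul, one_smul] at h1

omit H in
lemma isLattice_line (O : Subring E) (ϖ : Eˣ) (w : Fin 3 → E) : (lineLattice O ϖ w).IsLattice E where
  fg := (stdLattice O).2.fg.sup (Submodule.fg_span_singleton _)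
  span_eq_top := by
    rw [eq_top_iff, ← (stdLattice O).2.span_eq_top]
    exact Submodule.span_mono (le_sup_left (a := stdSubmodule O))

lemma exists_not_mem_plane {w : Fin 3 → E} (hw : IsPrimitive O ϖ w) :
    ∃ j : Fin 3, (Pi.single j 1 : Fin 3 → E) ∉ planeLattice O σ ϖ w := by
  obtain ⟨j, hj⟩ := hw.2
  refine ⟨j.rev, fun h => hj ?_⟩
  have h1 := H.conj_mem _ h.2
  rwa [herm_single_left, Fin.rev_rev, map_mul, H.conj_conj, H.conj_inv] at h1

/-- If `y ∈ O³` lies outside the plane, `h(y, w)` is a unit of `O`, so every `x` in `O³` falls into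
the plane after subtraction of a multiple of `y`. -/
lemma plane_covBy {w : Fin 3 → E} (hw : IsPrimitive O ϖ w) :
    planeLattice O σ ϖ w ⋖ stdSubmodule O := by
  refine ⟨lt_of_le_of_ne (fun x hx => hx.1) ?_, ?_⟩
  · intro h
    obtain ⟨j, hj⟩ := H.exists_not_mem_plane hw
    exact hj (h ▸ single_mem_std j)
  · intro N hN hN'
    obtain ⟨y, hyN, hy⟩ := Set.exists_of_ssubset hN
    have hy1 : y ∈ stdSubmodule O := hN'.le hyN
    have hy2 : ((ϖ⁻¹ : Eˣ) : E) * herm σ y w ∉ O := fun h => hy ⟨hy1, h⟩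
    obtain ⟨z, hz, h⟩ := H.exists_inv (H.herm_mem hy1 hw.1) hy2
    refine hN'.not_ge fun x hx => ?_
    have h1 : x - (herm σ x w * z) • y ∈ planeLattice O σ ϖ w := by
      refine ⟨sub_mem hx fun l => O.mul_mem (O.mul_mem (H.herm_mem hx hw.1) hz) (hy1 l), ?_⟩
      have : herm σ (x - (herm σ x w * z) • y) w = 0 := by
        rw [sub_eq_add_neg, ← neg_smul, herm_add_left, herm_smul_left]
        linear_combination -herm σ x w * h
      rw [this, mul_zero]
      exact O.zero_mem
    have h2 := N.smul_mem (⟨herm σ x w * z, O.mul_mem (H.herm_mem hx hw.1) hz⟩ : O) hyN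
    have h3 := add_mem (hN.le h1) h2
    rwa [Subring.smul_def, sub_add_cancel] at h3

/-- The dual of `planeLattice O σ ϖ w` is `lineLattice O ϖ w`. -/
lemma dual_plane {w : Fin 3 → E} (hw : IsPrimitive O ϖ w) :
    (lineLattice O ϖ w : Set (Fin 3 → E)) = dual σ (planeLattice O σ ϖ w) := by
  ext x
  constructor
  · intro hx y hy
    obtain ⟨m, hm, c, hc, rfl⟩ := mem_lineLattice.1 hx
    rw [herm_add_left, herm_smul_left]
    refine O.add_mem (H.herm_mem hm hy.1) (O.mul_mem hc ?_)
    change herm σ (((ϖ⁻¹ : Eˣ) : E) • w) y ∈ O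
    rw [herm_smul_left]
    have h1 := H.conj_mem _ hy.2
    rwa [map_mul, H.conj_inv, conj_herm H.conj_conj] at h1
  · intro hx
    obtain ⟨j, t, ht, h⟩ := H.exists_coord hw
    have hz : (ϖ : E) • x ∈ stdSubmodule O := by
      intro i
      have h1 := hx _ (H.unif_smul_mem_plane hw.1 (single_mem_std i.rev))
      rw [herm_smul_right, herm_single_right, H.conj_unif, Fin.rev_rev] at h1
      exact h1
    -- The coefficient is chosen to cancel the coordinate `j.rev`, where `w` has the inverse `σ t`.
    -- The coordinates that remain are the pairings of `x` with the vectors of `sub_mem_plane`.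
    refine mem_lineLattice.2 ⟨x - (ϖ * x j.rev * σ t) • ϖ⁻¹ • w, fun i => ?_, ϖ * x j.rev * σ t,
      O.mul_mem (hz _) (H.conj_mem _ ht), by rw [sub_add_cancel]⟩
    have h1 := hx _ (H.sub_mem_plane hw.1 ht h i.rev)
    rw [sub_eq_add_neg, ← neg_smul, herm_add_right, herm_smul_right, herm_single_right,
      herm_single_right, Fin.rev_rev, map_neg, map_mul, H.conj_conj] at h1
    have h2 : (x - (ϖ * x j.rev * σ t) • ϖ⁻¹ • w) i = x i + -(σ t * w i) * x j.rev := by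
      change x i - ϖ * x j.rev * σ t * (((ϖ⁻¹ : Eˣ) : E) * w i) = _
      have h3 : (ϖ : E) * ((ϖ⁻¹ : Eˣ) : E) = 1 := ϖ.mul_inv
      linear_combination -x j.rev * σ t * w i * h3
    rw [h2]
    exact h1

/-- A plane is not contained in a line. -/
lemma not_plane_le_line {w w' : Fin 3 → E} (hw : IsPrimitive O ϖ w) (hw' : w' ∈ stdSubmodule O) :
    ¬ planeLattice O σ ϖ w ≤ ϖ • lineLattice O ϖ w' := by
  intro hle
  obtain ⟨j, t, ht, h⟩ := H.exists_coord hw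
  have key (i : Fin 3) : ∃ m ∈ stdSubmodule O, ∃ c ∈ O,
      (Pi.single i 1 - (t * σ (w i.rev)) • Pi.single j 1 : Fin 3 → E) = (ϖ : E) • m + c • w' := by
    have h1 := hle (H.sub_mem_plane hw.1 ht h i)
    rw [mem_units_smul, mem_lineLattice] at h1
    obtain ⟨m, hm, c, hc, e⟩ := h1
    refine ⟨m, hm, c, hc, ?_⟩
    have e1 := congrArg (ϖ • ·) e
    simp only [smul_inv_smul, smul_add] at e1
    rw [e1]
    congr 1
    rw [smul_comm, smul_inv_smul]
  obtain ⟨i, l, hij, hlj, hil⟩ : ∃ i l : Fin 3, i ≠ j ∧ l ≠ j ∧ i ≠ l := by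
    fin_cases j
    · exact ⟨1, 2, by decide, by decide, by decide⟩
    · exact ⟨0, 2, by decide, by decide, by decide⟩
    · exact ⟨0, 1, by decide, by decide, by decide⟩
  obtain ⟨m, hm, c, hc, e⟩ := key i
  obtain ⟨m', hm', c', hc', e'⟩ := key l
  have e1 := congrFun e i
  have e2 := congrFun e l
  have e3 := congrFun e' l
  simp [hij, hlj, hil.symm] at e1 e2 e3
  -- Two vectors that are multiples of `w'` modulo `ϖ` have all their 2×2 minors divisible by `ϖ`,
  -- while the minor at `i, l` is one; `y` is the quotient of that minor by `ϖ`.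
  refine H.ne_unif_mul (y := m i * (ϖ * m' l + c' * w' l) + c * w' i * m' l - c' * w' i * m l)
    ?_ ?_
  · have := H.unif_mem
    exact O.sub_mem (O.add_mem (O.mul_mem (hm i) (O.add_mem (O.mul_mem this (hm' l))
      (O.mul_mem hc' (hw' l)))) (O.mul_mem (O.mul_mem hc (hw' i)) (hm' l)))
      (O.mul_mem (O.mul_mem hc' (hw' i)) (hm l))
  · linear_combination -(ϖ * m' l + c' * w' l) * e1 - e3 + c' * w' i * e2

/-- A plane determines its normal vector up to a scalar modulo `ϖ`; the scalar is read off at a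
coordinate where `w` is invertible. -/
lemma plane_proportional {w w' : Fin 3 → E} (hw : IsPrimitive O ϖ w) (hw' : w' ∈ stdSubmodule O)
    (h : planeLattice O σ ϖ w ≤ planeLattice O σ ϖ w') :
    ∃ u ∈ O, ∀ i, ((ϖ⁻¹ : Eˣ) : E) * (w' i - u * w i) ∈ O := by
  obtain ⟨j, t, ht, hj⟩ := H.exists_coord hw
  refine ⟨σ t * w' j.rev, O.mul_mem (H.conj_mem _ ht) (hw' _), fun i => ?_⟩
  have h1 := (h (H.sub_mem_plane hw.1 ht hj i.rev)).2
  rw [sub_eq_add_neg, ← neg_smul, herm_add_left, herm_smul_left, herm_single_left,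
    herm_single_left, Fin.rev_rev] at h1
  have h2 := H.conj_mem _ h1
  simp only [map_mul, map_add, map_neg, H.conj_conj, H.conj_inv] at h2
  convert h2 using 2
  ring

/-- The maximal sublattices of `O³` are the `planeLattice O σ ϖ w`. -/
lemma exists_plane {N : Submodule O (Fin 3 → E)} (hN : N ⋖ stdSubmodule O) :
    ∃ w, IsPrimitive O ϖ w ∧ N = planeLattice O σ ϖ w := by
  -- The quotient `O³/N` is simple, hence `O/I` with `I` maximal, and `I` turns out to be `ϖO`. So
  -- `N` is the kernel of a functional `O³ → O/ϖO`.
  have hs := (covBy_iff_quot_is_simple hN.le).1 hN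
  obtain ⟨I, hI, ⟨e⟩⟩ := isSimpleModule_iff_quot_maximal.1 hs
  have hI' (x : O) : x ∈ I ↔ ((ϖ⁻¹ : Eˣ) : E) * x ∈ O := by
    have h1 (x : O) (hx : x ∈ I) : ((ϖ⁻¹ : Eˣ) : E) * x ∈ O := by
      by_contra h
      obtain ⟨y, hy, hxy⟩ := H.exists_inv x.2 h
      refine hI.ne_top ((Ideal.eq_top_iff_one I).2 ?_)
      have : (1 : O) = x * ⟨y, hy⟩ := Subtype.ext hxy.symm
      rw [this]
      exact I.mul_mem_right _ hx
    refine ⟨h1 x, fun h => ?_⟩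
    by_contra hx
    obtain ⟨y, z, hz, hyz⟩ := hI.exists_inv hx
    refine H.ne_unif_mul (y := y * ((ϖ⁻¹ : Eˣ) * x) + ((ϖ⁻¹ : Eˣ) : E) * z)
      (O.add_mem (O.mul_mem y.2 h) (h1 z hz)) ?_
    have h3 : (ϖ : E) * ((ϖ⁻¹ : Eˣ) : E) = 1 := ϖ.mul_inv
    have h4 : (y : E) * x + z = 1 := congrArg Subtype.val hyz
    linear_combination h4 + (y * x + z) * h3
  let f : stdSubmodule O →ₗ[O] O ⧸ I := e.toLinearMap ∘ₗ Submodule.mkQ _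
  have hf (x : stdSubmodule O) : f x = 0 ↔ x.1 ∈ N := by
    simp [f]
  choose c hc using fun i : Fin 3 =>
    Ideal.Quotient.mk_surjective (f ⟨Pi.single i 1, single_mem_std i⟩)
  have hfx (x : stdSubmodule O) :
      f x = Ideal.Quotient.mk I (∑ i, (⟨x.1 i, x.2 i⟩ : O) * c i) := by
    have h1 : x = ∑ i, (⟨x.1 i, x.2 i⟩ : O) • (⟨Pi.single i 1, single_mem_std i⟩ :
        stdSubmodule O) := by
      refine Subtype.ext (funext fun j => ?_)
      simp [Finset.sum_apply, Pi.single_apply, Subring.smul_def]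
    conv_lhs => rw [h1]
    rw [map_sum, map_sum]
    refine Finset.sum_congr rfl fun i _ => ?_
    rw [map_smul, ← hc, map_mul]
    rfl
  -- The form pairs `eᵢ` with the reversed index and conjugates its second argument, so this vector
  -- represents the functional with coefficients `c`.
  have hNw : N = planeLattice O σ ϖ fun i => σ (c i.rev) := by
    ext x
    rw [mem_planeLattice]
    have h1 (hx : x ∈ stdSubmodule O) : x ∈ N ↔
        ((ϖ⁻¹ : Eˣ) : E) * herm σ x (fun i => σ (c i.rev)) ∈ O := by
      rw [← hf ⟨x, hx⟩, hfx, Ideal.Quotient.eq_zero_iff_mem, hI']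
      simp [herm_eq_sum, H.conj_conj]
    exact ⟨fun hx => ⟨hN.le hx, (h1 (hN.le hx)).1 hx⟩, fun hx => (h1 hx.1).2 hx.2⟩
  have hstd : (fun i : Fin 3 => σ (c i.rev)) ∈ stdSubmodule O := fun i => H.conj_mem _ (c _).2
  refine ⟨_, ⟨hstd, ?_⟩, hNw⟩
  by_contra! hall
  refine hN.lt.not_ge fun x hx => ?_
  rw [hNw]
  refine ⟨hx, ?_⟩
  rw [herm_eq_sum, Finset.mul_sum]
  refine O.sum_mem fun i _ => ?_
  rw [mul_left_comm]
  have := H.conj_mem _ (hall i.rev)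
  rw [map_mul, H.conj_inv] at this
  exact O.mul_mem (hx i) this

end IsLocalDatum

end Lattices

/-! ### Orbits of edges, base change of isometries and the residue field -/

/-- If the oriented edges with source `x` are sorted into three nonempty classes, and two of them are
in the same class exactly when they are in the same orbit, then the image of `x` in the quotient
graph has valency three. -/
lemma Graph.Action.valency_mkV_eq_three {Γ : Type*} [Group Γ] {𝔤 : Graph} (α : 𝔤.Action Γ)
    (x : 𝔤.V) (χ : 𝔤.E → Fin 3)
    (hχ : ∀ a b, 𝔤.s a = x → 𝔤.s b = x → (χ a = χ b ↔ ∃ g : Γ, α.actE.smul g a = b))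
    (hs : ∀ i, ∃ a, 𝔤.s a = x ∧ χ a = i) :
    α.quotient.valency (α.mkV x) = 3 := by
  let := α.actV
  let := α.actE
  choose D hD hDχ using hs
  let mk : 𝔤.E → α.quotient.E := Quotient.mk (MulAction.orbitRel Γ 𝔤.E)
  have hmk (a b : 𝔤.E) : mk a = mk b ↔ ∃ g : Γ, g • b = a :=
    Quotient.eq (r := MulAction.orbitRel Γ 𝔤.E)
  have hne {i j : Fin 3} (h : i ≠ j) : mk (D i) ≠ mk (D j) := by
    intro he
    obtain ⟨g, hg⟩ := (hmk _ _).1 he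
    have := (hχ _ _ (hD j) (hD i)).2 ⟨g, hg⟩
    rw [hDχ, hDχ] at this
    exact h this.symm
  refine Set.encard_eq_three.2 ⟨mk (D 0), mk (D 1), mk (D 2), hne (by decide), hne (by decide),
    hne (by decide), Set.ext fun e => ?_⟩
  constructor
  · intro he
    obtain ⟨a, rfl⟩ := Quotient.exists_rep e
    obtain ⟨g, hg⟩ : ∃ g : Γ, g • x = 𝔤.s a :=
      (Quotient.eq (r := MulAction.orbitRel Γ 𝔤.V)).1 he
    have hga : 𝔤.s (g⁻¹ • a) = x := by
      rw [α.smul_s, ← hg, inv_smul_smul]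
    obtain ⟨g', hg'⟩ := (hχ _ _ hga (hD (χ (g⁻¹ • a)))).1 (hDχ _).symm
    have h1 : mk (D (χ (g⁻¹ • a))) = mk a :=
      (hmk _ _).2 ⟨g' * g⁻¹, by rw [mul_smul]; exact hg'⟩
    change mk a ∈ _
    rw [← h1]
    generalize χ (g⁻¹ • a) = i
    fin_cases i <;> simp
  · have h (i : Fin 3) : α.quotient.s (mk (D i)) = α.mkV x := congrArg _ (hD i)
    rintro (rfl | rfl | rfl)
    exacts [h 0, h 1, h 2]

/-- The image of an isometry over `F` preserves the hermitian forms over extensions of `F` whose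
involution is trivial on `F`. -/
lemma herm_mulVec_map {F R : Type*} [Field F] [CommRing R] (f : F →+* R) (s : R →+* R)
    (hs : ∀ a, s (f a) = f a) {g : Matrix.SpecialLinearGroup (Fin 3) F}
    (hg : g ∈ SU (RingHom.id F)) (x y : Fin 3 → R) :
    herm s ((g.1.map f).mulVec x) ((g.1.map f).mulVec y) = herm s x y := by
  -- Invariance on pairs of basis vectors amounts to nine polynomial identities in the entries of
  -- `g`. They persist under `f`, and sesquilinearity extends them because `s` fixes the entries.
  have h (i j : Fin 3) := congrArg f (hg (Pi.single i 1) (Pi.single j 1))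
  have h00 := h 0 0
  have h01 := h 0 1
  have h02 := h 0 2
  have h10 := h 1 0
  have h11 := h 1 1
  have h12 := h 1 2
  have h20 := h 2 0
  have h21 := h 2 1
  have h22 := h 2 2
  simp [herm] at h00 h01 h02 h10 h11 h12 h20 h21 h22
  simp [herm, Matrix.mulVec, dotProduct, Fin.sum_univ_three, hs]
  linear_combination x 0 * s (y 0) * h00 + x 0 * s (y 1) * h01 + x 0 * s (y 2) * h02 +
    x 1 * s (y 0) * h10 + x 1 * s (y 1) * h11 + x 1 * s (y 2) * h12 +
    x 2 * s (y 0) * h20 + x 2 * s (y 1) * h21 + x 2 * s (y 2) * h22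

/-- An `IsLocalDatum` whose residue field is the quadratic extension of `F` generated by the image
of `θ`, with `θ² ≡ d`, on which the involution induces the conjugation. -/
structure IsUnramifiedDatum (F : Type*) {E : Type*} [Field F] [CommRing E] [Algebra F E]
    (O : Subring E) (σ : E →+* E) (ϖ : Eˣ) (θ : E) (d : F) : Prop extends IsLocalDatum O σ ϖ where
  two_ne : (2 : F) ≠ 0
  algebraMap_mem : ∀ a : F, algebraMap F E a ∈ O
  theta_mem : θ ∈ O
  conj_theta : σ θ = -θ
  conj_algebraMap : ∀ a : F, σ (algebraMap F E a) = algebraMap F E a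
  sq : ((ϖ⁻¹ : Eˣ) : E) * (θ ^ 2 - algebraMap F E d) ∈ O
  not_isSquare : ¬ IsSquare d
  residue : ∀ x ∈ O, ∃ a b : F,
    ((ϖ⁻¹ : Eˣ) : E) * (x - (algebraMap F E a + algebraMap F E b * θ)) ∈ O

/-- Here `k = O/ϖO` and `ε` is the class of `θ`. The involution descends because it fixes `ϖ⁻¹`,
hence preserves `ϖO`. -/
lemma IsUnramifiedDatum.exists_residueField.{u, v} {F : Type u} {E : Type v} [Field F] [CommRing E] [Algebra F E]
    {O : Subring E} {σ : E →+* E} {ϖ : Eˣ} {θ : E} {d : F} (H : IsUnramifiedDatum F O σ ϖ θ d) :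
    ∃ (k : Type v) (_ : Field k) (_ : Algebra F k) (ρ : O →+* k) (s : k →+* k) (ε : k),
      Function.Surjective ρ ∧ (∀ x, ρ x = 0 ↔ ((ϖ⁻¹ : Eˣ) : E) * x ∈ O) ∧
      (∀ x, s (ρ x) = ρ ⟨σ x, H.conj_mem x x.2⟩) ∧
      (∀ a : F, ρ ⟨algebraMap F E a, H.algebraMap_mem a⟩ = algebraMap F k a) ∧
      IsQuadratic F s ε d := by
  let p : O := ⟨ϖ, H.unif_mem⟩
  let I : Ideal O := Ideal.span {p}
  have hI (x : O) : x ∈ I ↔ ((ϖ⁻¹ : Eˣ) : E) * x ∈ O := by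
    rw [Ideal.mem_span_singleton']
    constructor
    · rintro ⟨y, rfl⟩
      have : ((ϖ⁻¹ : Eˣ) : E) * ((y * p : O) : E) = y := by
        rw [mul_comm y p, Subring.coe_mul, Units.inv_mul_cancel_left]
      rw [this]
      exact y.2
    · intro h
      refine ⟨⟨_, h⟩, Subtype.ext ?_⟩
      change ((ϖ⁻¹ : Eˣ) : E) * x * ϖ = x
      rw [mul_right_comm, Units.inv_mul, one_mul]
  have hmax : I.IsMaximal := by
    refine Ideal.isMaximal_iff.2 ⟨fun h => ?_, fun J x hIJ hx hxJ => ?_⟩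
    · rw [hI] at h
      exact H.inv_not_mem (by simpa using h)
    · rw [hI] at hx
      obtain ⟨y, hy, hxy⟩ := H.exists_inv x.2 hx
      have : (1 : O) = x * ⟨y, hy⟩ := Subtype.ext hxy.symm
      rw [this]
      exact J.mul_mem_right _ hxJ
  let ρ : O →+* O ⧸ I := Ideal.Quotient.mk I
  have hρ (x : O) : ρ x = 0 ↔ ((ϖ⁻¹ : Eˣ) : E) * x ∈ O :=
    Ideal.Quotient.eq_zero_iff_mem.trans (hI x)
  have hρeq (x y : O) (h : ((ϖ⁻¹ : Eˣ) : E) * ((x : E) - y) ∈ O) : ρ x = ρ y :=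
    sub_eq_zero.1 ((map_sub ρ x y).symm.trans ((hρ _).2 h))
  let ι : F →+* O := (algebraMap F E).codRestrict O H.algebraMap_mem
  let σO : O →+* O := (σ.comp O.subtype).codRestrict O fun x => H.conj_mem x x.2
  let _ : Field (O ⧸ I) := Ideal.Quotient.field I
  let _ : Algebra F (O ⧸ I) := (ρ.comp ι).toAlgebra
  refine ⟨O ⧸ I, inferInstance, inferInstance, ρ,
    Ideal.Quotient.lift I (ρ.comp σO) fun x hx => ?_, ρ ⟨θ, H.theta_mem⟩,
    Ideal.Quotient.mk_surjective, hρ, fun x => rfl, fun a => rfl, ?_⟩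
  · rw [hI] at hx
    refine (hρ _).2 ?_
    have := H.conj_mem _ hx
    rwa [map_mul, H.conj_inv] at this
  · refine ⟨H.two_ne, ?_, H.not_isSquare, ?_, ?_, ?_⟩
    · exact hρeq (⟨θ, H.theta_mem⟩ ^ 2) (ι d) H.sq
    · intro x
      obtain ⟨x, rfl⟩ := Ideal.Quotient.mk_surjective x
      obtain ⟨a, b, h⟩ := H.residue x x.2
      exact ⟨a, b, hρeq x (ι a + ι b * (⟨θ, H.theta_mem⟩ : O)) h⟩
    · intro a
      exact congrArg ρ (Subtype.ext (H.conj_algebraMap a) : σO (ι a) = ι a)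
    · exact congrArg ρ (Subtype.ext H.conj_theta : σO ⟨θ, H.theta_mem⟩ = -⟨θ, H.theta_mem⟩)

/-! ### Edges at the standard vertex and isotropic points modulo the uniformizer -/

section Neighbors

variable {E : Type*} [CommRing E] {O : Subring E} {σ : E →+* E} {ϖ : Eˣ}

namespace IsLocalDatum

variable (H : IsLocalDatum O σ ϖ)
include H

lemma plane_le_plane {w w' : Fin 3 → E} {u : E} (hu : u ∈ O)
    (h : ∀ i, ((ϖ⁻¹ : Eˣ) : E) * (w' i - u * w i) ∈ O) :
    planeLattice O σ ϖ w ≤ planeLattice O σ ϖ w' := by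
  intro x hx
  refine ⟨hx.1, ?_⟩
  have h1 : ((ϖ⁻¹ : Eˣ) : E) * herm σ x w' = ∑ i, x i * σ (((ϖ⁻¹ : Eˣ) : E) *
      (w' i.rev - u * w i.rev)) + σ u * (((ϖ⁻¹ : Eˣ) : E) * herm σ x w) := by
    rw [herm_eq_sum, herm_eq_sum, Finset.mul_sum, Finset.mul_sum, Finset.mul_sum,
      ← Finset.sum_add_distrib]
    refine Finset.sum_congr rfl fun i _ => ?_
    simp only [map_mul, map_sub, H.conj_inv]
    ring
  rw [h1]
  exact O.add_mem (O.sum_mem fun i _ => O.mul_mem (hx.1 i) (H.conj_mem _ (h _)))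
    (O.mul_mem (H.conj_mem _ hu) hx.2)

lemma plane_eq_of_le {w w' : Fin 3 → E} (hw : IsPrimitive O ϖ w) (hw' : IsPrimitive O ϖ w')
    (h : planeLattice O σ ϖ w ≤ planeLattice O σ ϖ w') :
    planeLattice O σ ϖ w = planeLattice O σ ϖ w' :=
  (((H.plane_covBy hw).eq_or_eq h (H.plane_covBy hw').le).resolve_right
    (H.plane_covBy hw').ne).symm

omit H in
lemma std_le_line (w : Fin 3 → E) : stdSubmodule O ≤ lineLattice O ϖ w := le_sup_left

omit H in
lemma not_line_le_std {w : Fin 3 → E} (hw : IsPrimitive O ϖ w) :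
    ¬ lineLattice O ϖ w ≤ stdSubmodule O := by
  intro h
  obtain ⟨j, hj⟩ := hw.2
  have h1 : ϖ⁻¹ • w ∈ lineLattice O ϖ w :=
    mem_lineLattice.2 ⟨0, zero_mem _, 1, O.one_mem, by simp⟩
  exact hj (h h1 j)

omit H in
lemma zpow_smul_mono {N N' : Submodule O (Fin 3 → E)} (h : N ≤ N') (n : ℤ) :
    ϖ ^ n • N ≤ ϖ ^ n • N' := by
  intro x hx
  rw [mem_units_smul] at hx ⊢
  exact h hx

/-- The uniformizer is unique up to units. -/
lemma irreducible_dvd {π : O} (hπ : Irreducible π) : ∃ y : O, (ϖ : E) = π * y := by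
  have h1 : ((ϖ⁻¹ : Eˣ) : E) * π ∈ O := by
    by_contra h
    obtain ⟨y, hy, hxy⟩ := H.exists_inv π.2 h
    exact hπ.not_isUnit (IsUnit.of_mul_eq_one ⟨y, hy⟩ (Subtype.ext hxy))
  have h2 : π = ⟨ϖ, H.unif_mem⟩ * ⟨_, h1⟩ :=
    Subtype.ext (Units.mul_inv_cancel_left ϖ (π : E)).symm
  rcases hπ.isUnit_or_isUnit h2 with h | h
  · obtain ⟨y, hy⟩ := h.exists_right_inv
    exact (H.ne_unif_mul y.2 (congrArg Subtype.val hy)).elim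
  · obtain ⟨y, hy⟩ := h.exists_right_inv
    refine ⟨y, ?_⟩
    have h3 : π * y = ⟨ϖ, H.unif_mem⟩ := by
      rw [h2, mul_assoc, hy, mul_one]
    exact (congrArg Subtype.val h3).symm

lemma irreducible_unif : Irreducible (⟨ϖ, H.unif_mem⟩ : O) where
  not_isUnit h := by
    obtain ⟨y, hy⟩ := h.exists_right_inv
    exact H.ne_unif_mul y.2 (congrArg Subtype.val hy)
  isUnit_or_isUnit {x y} h := by
    by_contra! hxy
    have h1 (x : O) (hx : ¬ IsUnit x) : ((ϖ⁻¹ : Eˣ) : E) * x ∈ O := by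
      by_contra h
      obtain ⟨y, hy, hxy⟩ := H.exists_inv x.2 h
      exact hx (IsUnit.of_mul_eq_one ⟨y, hy⟩ (Subtype.ext hxy))
    have h2 : (ϖ : E) = x * y := congrArg Subtype.val h
    refine H.ne_unif_mul (O.mul_mem (h1 x hxy.1) (h1 y hxy.2)) ?_
    have h3 : (ϖ : E) * ((ϖ⁻¹ : Eˣ) : E) = 1 := ϖ.mul_inv
    linear_combination (((ϖ⁻¹ : Eˣ) : E) * x * y + 1) * h3 - ((ϖ⁻¹ : Eˣ) : E) * h2

/-- Normal form of adjacency: one representative is kept fixed, the other is a `ϖ`-power multiple,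
and the arbitrary prime is replaced by `ϖ`. -/
lemma exists_of_adj {Λ Λ' : Lattice O} (h : BuildingAdj Λ.cls Λ'.cls) :
    ∃ n : ℤ, ϖ • Λ.1 ≤ ϖ ^ n • Λ'.1 ∧ ϖ ^ n • Λ'.1 ≤ Λ.1 := by
  obtain ⟨N, N', hN, hN', π, hπ, h1, h2⟩ := h
  obtain ⟨a, ha⟩ := H.exists_zpow_smul hN
  obtain ⟨b, hb⟩ := H.exists_zpow_smul hN'
  obtain ⟨y, hy⟩ := H.irreducible_dvd hπ
  have h3 : ϖ • N.1 ≤ N'.1 := by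
    intro x hx
    rw [mem_units_smul] at hx
    refine h1.le (Submodule.mem_smul_pointwise_iff_exists _ _ _ |>.2 ⟨y • ϖ⁻¹ • x,
      N.1.smul_mem _ hx, ?_⟩)
    rw [smul_smul, Subring.smul_def, Subring.coe_mul, ← hy]
    exact smul_inv_smul ϖ x
  have h4 := h2.le
  rw [ha, hb] at h3 h4
  have h5 := zpow_smul_mono (ϖ := ϖ) h3 (-a)
  have h6 := zpow_smul_mono (ϖ := ϖ) h4 (-a)
  refine ⟨-a + b, ?_, ?_⟩
  · rwa [smul_smul, smul_smul, smul_smul, mul_right_comm, ← zpow_add, ← zpow_add,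
      neg_add_cancel, zpow_zero, one_mul] at h5
  · rwa [smul_smul, smul_smul, ← zpow_add, ← zpow_add, neg_add_cancel, zpow_zero, one_smul] at h6

/-- The class of a maximal sublattice of `O³` and of its dual are neighbors only if the sublattice
is attached to an isotropic vector. -/
lemma isotropic_of_adj {w : Fin 3 → E} (hw : IsPrimitive O ϖ w) {Λ Λ' : Lattice O}
    (hΛ : Λ.1 = planeLattice O σ ϖ w) (hΛ' : Λ'.1 = lineLattice O ϖ w)
    (h : BuildingAdj Λ.cls Λ'.cls ∨ BuildingAdj Λ'.cls Λ.cls) :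
    ((ϖ⁻¹ : Eˣ) : E) * herm σ w w ∈ O := by
  -- The left side contains `w`, so the inclusion says that `w` is orthogonal to itself modulo `ϖ`.
  -- Exponents that do not give it directly would put the plane inside `ϖ` times the line lattice,
  -- against `not_plane_le_line`.
  suffices hle : ϖ • lineLattice O ϖ w ≤ planeLattice O σ ϖ w by
    refine (hle ((mem_units_smul _ _ _).2 ?_)).2
    exact mem_lineLattice.2 ⟨0, zero_mem _, 1, O.one_mem, by simp⟩
  have hX := H.not_plane_le_line hw hw.1
  rcases h with h | h
  · obtain ⟨n, h1, h2⟩ := H.exists_of_adj h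
    rw [hΛ, hΛ'] at h1 h2
    rcases le_or_gt n 1 with hn | hn
    · have := (H.smul_le_smul hn (lineLattice O ϖ w)).trans h2
      rwa [zpow_one] at this
    · refine (hX fun x hx => ?_).elim
      have h3 : ϖ • x ∈ ϖ ^ (1 + 1 : ℤ) • lineLattice O ϖ w :=
        H.smul_le_smul (by omega) _ (h1 ((mem_units_smul _ _ _).2 (by rwa [inv_smul_smul])))
      rw [zpow_one_add, zpow_one, mul_smul, mem_units_smul, inv_smul_smul] at h3
      exact h3
  · obtain ⟨n, h1, h2⟩ := H.exists_of_adj h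
    rw [hΛ, hΛ'] at h1 h2
    rcases le_or_gt 0 n with hn | hn
    · have := h1.trans (H.smul_le_smul hn (planeLattice O σ ϖ w))
      rwa [zpow_zero, one_smul] at this
    · refine (hX fun x hx => ?_).elim
      have h3 : ϖ⁻¹ • x ∈ ϖ ^ (-1 : ℤ) • planeLattice O σ ϖ w := by
        rw [mem_units_smul, zpow_neg_one, inv_smul_smul]
        exact hx
      rw [mem_units_smul]
      exact h2 (H.smul_le_smul (by omega) _ h3)

/-- A maximal sublattice of `O³` is determined by its class, and is not homothetic to the dual of
another one. -/
lemma plane_eq_of_pair_eq {w w' : Fin 3 → E} (hw : IsPrimitive O ϖ w) (hw' : IsPrimitive O ϖ w')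
    {Λ Λ' M M' : Lattice O} (hΛ : Λ.1 = planeLattice O σ ϖ w)
    (hM : M.1 = planeLattice O σ ϖ w') (hM' : M'.1 = lineLattice O ϖ w')
    (h : s(Λ.cls, Λ'.cls) = s(M.cls, M'.cls)) :
    planeLattice O σ ϖ w = planeLattice O σ ϖ w' := by
  -- A positive exponent would push a plane into `ϖ` times a line lattice; this excludes every
  -- homothety except equality of the planes.
  have hpos {w w' : Fin 3 → E} (hw : IsPrimitive O ϖ w) (hw' : IsPrimitive O ϖ w') {n : ℤ}
      (hn : 1 ≤ n) (N : Submodule O (Fin 3 → E)) (hN : N ≤ lineLattice O ϖ w')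
      (h : planeLattice O σ ϖ w = ϖ ^ n • N) : False := by
    refine H.not_plane_le_line hw hw'.1 ?_
    have := (H.smul_le_smul hn N).trans (zpow_smul_mono hN 1)
    rw [← h, zpow_one] at this
    exact this
  have hpl (w : Fin 3 → E) : planeLattice O σ ϖ w ≤ lineLattice O ϖ w :=
    fun x hx => std_le_line w hx.1
  rcases Sym2.eq_iff.1 h with ⟨h, -⟩ | ⟨h, -⟩
  · obtain ⟨n, hn⟩ := H.exists_zpow_smul h
    rw [hΛ, hM] at hn
    rcases lt_trichotomy n 0 with h0 | rfl | h0
    · refine (hpos hw' hw (n := -n) (by omega) _ (hpl w) ?_).elim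
      rw [hn, smul_smul, ← zpow_add, neg_add_cancel, zpow_zero, one_smul]
    · rwa [zpow_zero, one_smul] at hn
    · exact (hpos hw hw' (by omega) _ (hpl w') hn).elim
  · obtain ⟨n, hn⟩ := H.exists_zpow_smul h
    rw [hΛ, hM'] at hn
    rcases le_or_gt 1 n with h0 | h0
    · exact (hpos hw hw' h0 _ le_rfl hn).elim
    · refine (IsLocalDatum.not_line_le_std hw' ?_).elim
      have := H.smul_le_smul (m := n) (n := 0) (by omega) (lineLattice O ϖ w')
      rw [zpow_zero, one_smul, ← hn] at this
      exact this.trans (H.plane_covBy hw).le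

end IsLocalDatum

/-- The primitive vectors that are isotropic modulo `ϖ`. -/
structure IsotropicVector (O : Subring E) (σ : E →+* E) (ϖ : Eˣ) where
  vec : Fin 3 → E
  isPrimitive : IsPrimitive O ϖ vec
  isotropic : ((ϖ⁻¹ : Eˣ) : E) * herm σ vec vec ∈ O

namespace IsotropicVector

variable (H : IsLocalDatum O σ ϖ) (w : IsotropicVector O σ ϖ)

def plane : Lattice O := ⟨planeLattice O σ ϖ w.vec, H.isLattice_plane w.isPrimitive⟩

omit H in
def line : Lattice O := ⟨lineLattice O ϖ w.vec, IsLocalDatum.isLattice_line O ϖ w.vec⟩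

include H in
lemma unif_smul_line_le : ϖ • lineLattice O ϖ w.vec ≤ planeLattice O σ ϖ w.vec := by
  intro x hx
  rw [mem_units_smul, mem_lineLattice] at hx
  obtain ⟨m, hm, c, hc, e⟩ := hx
  have hx : x = (ϖ : E) • m + c • w.vec := by
    have e1 := congrArg (ϖ • ·) e
    simp only [smul_inv_smul, smul_add] at e1
    rw [e1]
    congr 1
    rw [smul_comm, smul_inv_smul]
  rw [hx]
  refine add_mem (H.unif_smul_mem_plane w.isPrimitive.1 hm) ?_
  exact Submodule.smul_mem _ (⟨c, hc⟩ : O) (x := w.vec) ⟨w.isPrimitive.1, w.isotropic⟩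

lemma isDual : IsDual σ (w.plane H) w.line := H.dual_plane w.isPrimitive

lemma isDualPair : IsDualPair σ s((w.plane H).cls, w.line.cls) := by
  -- The dual is rescaled by `ϖ`. Modulo `ϖO³` it becomes the line of `w`, which isotropy places in
  -- the plane, properly because the plane has dimension two.
  refine ⟨w.plane H, w.line, w.isDual H, ⟨w.plane H, ϖ • w.line, rfl,
    cls_eq_iff.2 ⟨ϖ, rfl⟩, ⟨ϖ, H.unif_mem⟩, H.irreducible_unif, ?_, ?_⟩, rfl⟩
  · change ϖ • planeLattice O σ ϖ w.vec < ϖ • lineLattice O ϖ w.vec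
    refine lt_of_le_not_ge ?_ fun h => ?_
    · have := IsLocalDatum.zpow_smul_mono ((H.plane_covBy w.isPrimitive).le.trans
        (IsLocalDatum.std_le_line (ϖ := ϖ) w.vec)) 1 (ϖ := ϖ)
      rwa [zpow_one] at this
    · refine IsLocalDatum.not_line_le_std w.isPrimitive fun x hx => ?_
      have h1 := h ((mem_units_smul ϖ _ (ϖ • x)).2 (by rwa [inv_smul_smul]))
      rw [mem_units_smul, inv_smul_smul] at h1
      exact h1.1
  · exact lt_of_le_not_ge (w.unif_smul_line_le H)
      (H.not_plane_le_line w.isPrimitive w.isPrimitive.1)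

/-- The oriented edge from `[O³]` attached to an isotropic vector. -/
def dart : (tree O σ).Dart :=
  ⟨(specialVertex O σ H.conj_mem, .pair s((w.plane H).cls, w.line.cls) (w.isDualPair H)),
    ⟨stdLattice O, w.plane H, w.line, stdLattice_isDual O H.conj_mem, w.isDual H,
      H.plane_covBy w.isPrimitive, rfl, rfl⟩⟩

include H in
lemma line_eq_of_isDual {Λ Λ' : Lattice O} (hd : IsDual σ Λ Λ')
    (h : Λ.1 = planeLattice O σ ϖ w.vec) : Λ'.1 = lineLattice O ϖ w.vec := by
  refine SetLike.coe_injective ?_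
  rw [hd, h]
  exact (H.dual_plane w.isPrimitive).symm

/-- Every edge from `[O³]` is attached to an isotropic vector. -/
lemma exists_dart (a : (tree O σ).Dart) (ha : a.fst = specialVertex O σ H.conj_mem) :
    ∃ w : IsotropicVector O σ ϖ, a = w.dart H := by
  obtain ⟨⟨x, y⟩, hadj⟩ := a
  obtain rfl : x = specialVertex O σ H.conj_mem := ha
  rcases y with ⟨c, hc⟩ | ⟨p, hp⟩
  · exact hadj.elim
  obtain ⟨M, Λ, Λ', hM, hΛ, hcov, hcls, rfl⟩ := hadj
  rw [H.eq_std_of_unimodular hM hcls] at hcov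
  obtain ⟨w, hw, hplane⟩ := H.exists_plane hcov
  have hline : Λ'.1 = lineLattice O ϖ w := by
    refine SetLike.coe_injective ?_
    rw [hΛ, hplane]
    exact (H.dual_plane hw).symm
  -- Isotropy comes from the pair being a vertex, not from incidence. The pair is unordered, so the
  -- adjacency may come in either order.
  have hiso : ((ϖ⁻¹ : Eˣ) : E) * herm σ w w ∈ O := by
    refine H.isotropic_of_adj hw hplane hline ?_
    obtain ⟨N, N', -, hadj, e⟩ := hp
    rcases Sym2.eq_iff.1 e with ⟨e1, e2⟩ | ⟨e1, e2⟩
    · exact Or.inl (e1 ▸ e2 ▸ hadj)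
    · exact Or.inr (e1 ▸ e2 ▸ hadj)
  refine ⟨⟨w, hw, hiso⟩, ?_⟩
  obtain rfl : Λ = plane H ⟨w, hw, hiso⟩ := Subtype.ext hplane
  obtain rfl : Λ' = line ⟨w, hw, hiso⟩ := Subtype.ext hline
  rfl

/-- Two isotropic vectors give the same edge if and only if they are proportional modulo `ϖ`. -/
lemma dart_eq_iff (w w' : IsotropicVector O σ ϖ) : w.dart H = w'.dart H ↔
    ∃ u ∈ O, ∀ i, ((ϖ⁻¹ : Eˣ) : E) * (w'.vec i - u * w.vec i) ∈ O := by
  constructor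
  · intro h
    have h1 : (w.dart H).snd = (w'.dart H).snd := by rw [h]
    have h2 : s((w.plane H).cls, w.line.cls) = s((w'.plane H).cls, w'.line.cls) :=
      Vertex.pair.inj h1
    have h3 := H.plane_eq_of_pair_eq w.isPrimitive w'.isPrimitive (Λ := w.plane H)
      (M := w'.plane H) rfl rfl rfl h2
    exact H.plane_proportional w.isPrimitive w'.isPrimitive.1 h3.le
  · rintro ⟨u, hu, h⟩
    have h1 := H.plane_eq_of_le w.isPrimitive w'.isPrimitive (H.plane_le_plane hu h)
    have h2 : w.plane H = w'.plane H := Subtype.ext h1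
    have h3 : w.line = w'.line := Subtype.ext (w'.line_eq_of_isDual H (w.isDual H) h1)
    refine SimpleGraph.Dart.ext _ _ (Prod.ext rfl ?_)
    simp only [dart, h2, h3]

end IsotropicVector

/-! ### The action of the stabilizer on the edges at the standard vertex -/

section Action

variable (H : IsLocalDatum O σ ϖ)
include H

/-- The stabilizer of `[O³]` stabilizes `O³`. -/
lemma IsLocalDatum.smul_std_eq {g : SU σ}
    (h : g • specialVertex O σ H.conj_mem = specialVertex O σ H.conj_mem) :
    (g.1 • stdLattice O).1 = stdSubmodule O := by
  refine H.eq_std_of_unimodular ((stdLattice_isDual O H.conj_mem).smul g.1 g.2) ?_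
  exact Vertex.unimodular.inj h

omit H in
lemma mulVec_mem_std_iff {g : SU σ} (h : (g.1 • stdLattice O).1 = stdSubmodule O)
    (x : Fin 3 → E) : g.1.1.mulVec x ∈ stdSubmodule O ↔ x ∈ stdSubmodule O := by
  constructor
  · intro hx
    rw [← h] at hx
    obtain ⟨y, hy, e⟩ := hx
    rwa [← matAct_injective g.1 e]
  · intro hx
    rw [← h]
    exact ⟨x, hx, rfl⟩

omit H in
/-- The image of an isotropic vector under the stabilizer of `O³`. -/
def IsotropicVector.smul (w : IsotropicVector O σ ϖ) (g : SU σ)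
    (h : (g.1 • stdLattice O).1 = stdSubmodule O) : IsotropicVector O σ ϖ where
  vec := g.1.1.mulVec w.vec
  isPrimitive := by
    refine ⟨(mulVec_mem_std_iff h _).2 w.isPrimitive.1, ?_⟩
    by_contra! hall
    obtain ⟨j, hj⟩ := w.isPrimitive.2
    have h1 : ((ϖ⁻¹ : Eˣ) : E) • g.1.1.mulVec w.vec ∈ stdSubmodule O := hall
    rw [← Matrix.mulVec_smul, mulVec_mem_std_iff h] at h1
    exact hj (h1 j)
  isotropic := by
    rw [g.2]
    exact w.isotropic

/-- Since `g` preserves both `O³` and the form, it carries the plane of `w` to the plane of `gw`;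
the line lattices follow by duality. -/
lemma IsotropicVector.smul_dart (w : IsotropicVector O σ ϖ) {Γ : Subgroup (SU σ)} (g : Γ)
    (h : (g.1.1 • stdLattice O).1 = stdSubmodule O) :
    (treeAction O Γ).actE.smul g (w.dart H) = (w.smul g.1 h).dart H := by
  have hstd : g.1.1 • stdLattice O = stdLattice O := Subtype.ext h
  have hp : g.1.1 • w.plane H = (w.smul g.1 h).plane H := by
    refine Subtype.ext (Submodule.ext fun x => ?_)
    obtain ⟨y, rfl⟩ : ∃ y, g.1.1.1.mulVec y = x := ⟨_, matAct_inv_cancel g.1.1 x⟩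
    have h1 : g.1.1.1.mulVec y ∈ (g.1.1 • w.plane H).1 ↔ y ∈ planeLattice O σ ϖ w.vec := by
      constructor
      · rintro ⟨z, hz, e⟩
        rwa [← matAct_injective g.1.1 e]
      · exact fun hy => ⟨y, hy, rfl⟩
    rw [h1]
    change _ ↔ _ ∈ planeLattice O σ ϖ (g.1.1.1.mulVec w.vec)
    rw [mem_planeLattice, mem_planeLattice, mulVec_mem_std_iff h, g.1.2]
  have hl : g.1.1 • w.line = (w.smul g.1 h).line :=
    Subtype.ext ((w.smul g.1 h).line_eq_of_isDual H ((w.isDual H).smul g.1.1 g.1.2)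
      (congrArg Subtype.val hp))
  refine SimpleGraph.Dart.ext _ _ (Prod.ext ?_ ?_)
  · change Vertex.unimodular (g.1.1 • stdLattice O).cls _ = Vertex.unimodular (stdLattice O).cls _
    simp only [hstd]
  · change Vertex.pair s((g.1.1 • w.plane H).cls, (g.1.1 • w.line).cls) _ = Vertex.pair _ _
    simp only [hp, hl]

end Action

end Neighbors

/-! ### Square classes and the count of orbits -/

/-- The zero class and the two classes modulo squares. -/
noncomputable def squareClass {k : Type*} [Field k] (β : k) : Fin 3 :=
  open Classical in if β = 0 then 0 else if IsSquare β then 1 else 2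

/-- The multiplicative form is the one that `IsQuadratic.exists_isometry_of_form` consumes.
Finiteness enters where both are nonsquares. -/
lemma squareClass_eq_iff {k : Type*} [Field k] [Finite k] (h2 : (2 : k) ≠ 0) (β β' : k) :
    squareClass β = squareClass β' ↔ ((β = 0 ↔ β' = 0) ∧ IsSquare (β * β')) := by
  have hdiv {x y : k} (hx : x ≠ 0) (hxy : IsSquare (x * y)) (h : IsSquare x) : IsSquare y := by
    have : y = x * y / x := by field_simp
    rw [this]
    exact hxy.div h
  by_cases h : β = 0
  · subst h
    by_cases h' : β' = 0
    · simp [h', squareClass]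
    · by_cases hs' : IsSquare β' <;> simp [squareClass, h', hs']
  · by_cases h' : β' = 0
    · by_cases hs : IsSquare β <;> simp [squareClass, h', h, hs, eq_comm]
    · by_cases hs : IsSquare β <;> by_cases hs' : IsSquare β'
      · simp [squareClass, h, h', hs, hs', hs.mul hs']
      · simp only [squareClass, h, h', hs, hs', if_true, if_false, true_and]
        exact ⟨fun h => by simp at h, fun h1 => (hs' (hdiv h h1 hs)).elim⟩
      · simp only [squareClass, h, h', hs, hs', if_true, if_false, true_and]
        exact ⟨fun h => by simp at h, fun h1 => (hs (hdiv h' (mul_comm β β' ▸ h1) hs')).elim⟩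
      · simp [squareClass, h, h', hs, hs', isSquare_mul_of_not_isSquare h2 hs hs']

/-- If the stabilizer of `[O³]` in `Γ` is the group of isometries over the finite field `F`, then
the image of `[O³]` in the quotient graph has valency three. -/
theorem IsUnramifiedDatum.valency_eq_three {F E : Type*} [Field F] [Finite F] [CommRing E]
    [Algebra F E] {O : Subring E} {σ : E →+* E} {ϖ : Eˣ} {θ : E} {d : F}
    (H : IsUnramifiedDatum F O σ ϖ θ d) (Γ : Subgroup (SU σ))
    (hΓ : ∀ g ∈ Γ, (∀ i j, g.1.1 i j ∈ O) → ∃ g₀ : Matrix.SpecialLinearGroup (Fin 3) F,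
      g.1 = Matrix.SpecialLinearGroup.map (algebraMap F E) g₀)
    (hΓ' : ∀ g : SU σ, ∀ g₀ : Matrix.SpecialLinearGroup (Fin 3) F,
      g.1 = Matrix.SpecialLinearGroup.map (algebraMap F E) g₀ → g ∈ Γ) :
    (treeAction O Γ).quotient.valency
      ((treeAction O Γ).mkV (specialVertex O σ H.conj_mem)) = 3 := by
  have HL : IsLocalDatum O σ ϖ := H.toIsLocalDatum
  have := HL.nontrivial
  obtain ⟨k, _, _, ρ, s, ε, hsurj, hker, hs, hρF, hQ⟩ := H.exists_residueField
  have : Finite k := hQ.finite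
  let σO : O →+* O := (σ.comp O.subtype).codRestrict O fun x => H.conj_mem x x.2
  let val (w : IsotropicVector O σ ϖ) : Fin 3 → k := fun i => ρ ⟨w.vec i, w.isPrimitive.1 i⟩
  have hρeq (x y : O) : ρ x = ρ y ↔ ((ϖ⁻¹ : Eˣ) : E) * ((x : E) - y) ∈ O := by
    rw [← sub_eq_zero, ← map_sub, hker]
    rfl
  have hcoe (x : Fin 3 → O) : ((herm σO x x : O) : E) = herm σ (fun i => x i) (fun i => x i) := rfl
  have hval_ne (w : IsotropicVector O σ ϖ) : val w ≠ 0 := by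
    obtain ⟨j, hj⟩ := w.isPrimitive.2
    exact fun h => hj ((hker _).1 (congrFun h j))
  have hval_herm (w : IsotropicVector O σ ϖ) : herm s (val w) (val w) = 0 := by
    have h1 := IsQuadratic.herm_map s ρ σO hs (fun i => ⟨w.vec i, w.isPrimitive.1 i⟩)
      (fun i => ⟨w.vec i, w.isPrimitive.1 i⟩)
    refine h1.trans ((hker _).2 ?_)
    rw [hcoe]
    exact w.isotropic
  have hval_surj (v : Fin 3 → k) (hv : v ≠ 0) (hv' : herm s v v = 0) : ∃ w, val w = v := by
    choose x hx using fun i => hsurj (v i)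
    refine ⟨⟨fun i => x i, ⟨fun i => (x i).2, ?_⟩, ?_⟩, funext hx⟩
    · obtain ⟨j, hj⟩ := Function.ne_iff.1 hv
      refine ⟨j, fun h => hj ?_⟩
      rw [← hx j]
      exact (hker _).2 h
    · have h1 := IsQuadratic.herm_map s ρ σO hs x x
      have h2 : ρ ∘ x = v := funext hx
      rw [h2, hv', eq_comm, hker, hcoe] at h1
      exact h1
  have hval_eq (w w' : IsotropicVector O σ ϖ) :
      w.dart HL = w'.dart HL ↔ ∃ u : k, val w' = u • val w := by
    rw [IsotropicVector.dart_eq_iff]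
    constructor
    · rintro ⟨u, hu, h⟩
      refine ⟨ρ ⟨u, hu⟩, funext fun i => ?_⟩
      rw [Pi.smul_apply, smul_eq_mul, ← map_mul, hρeq]
      exact h i
    · rintro ⟨u, h⟩
      obtain ⟨u, rfl⟩ := hsurj u
      refine ⟨u, u.2, fun i => ?_⟩
      have h1 := congrFun h i
      rw [Pi.smul_apply, smul_eq_mul, ← map_mul, hρeq] at h1
      exact h1
  have hval_smul (w : IsotropicVector O σ ϖ) (g : SU σ)
      (h : (g.1 • stdLattice O).1 = stdSubmodule O) (g₀ : Matrix.SpecialLinearGroup (Fin 3) F)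
      (hg : g.1 = Matrix.SpecialLinearGroup.map (algebraMap F E) g₀) :
      val (w.smul g h) = (g₀.1.map (algebraMap F k)).mulVec (val w) := by
    funext i
    have h1 : (⟨(w.smul g h).vec i, (w.smul g h).isPrimitive.1 i⟩ : O) =
        ∑ j, ⟨algebraMap F E (g₀.1 i j), H.algebraMap_mem _⟩ *
          ⟨w.vec j, w.isPrimitive.1 j⟩ := by
      refine Subtype.ext ?_
      rw [AddSubmonoidClass.coe_finsetSum]
      change (g.1.1.mulVec w.vec) i = _
      rw [hg]
      rfl
    change ρ _ = _
    rw [h1, map_sum]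
    change _ = ∑ j, algebraMap F k (g₀.1 i j) * val w j
    refine Finset.sum_congr rfl fun j _ => ?_
    rw [map_mul, hρF]
  have hisom (g : SU σ) (g₀ : Matrix.SpecialLinearGroup (Fin 3) F)
      (hg : g.1 = Matrix.SpecialLinearGroup.map (algebraMap F E) g₀) :
      g₀ ∈ SU (RingHom.id F) := by
    intro x y
    refine (algebraMap F E).injective ?_
    have h1 (a b : Fin 3 → F) : herm σ (algebraMap F E ∘ a) (algebraMap F E ∘ b) =
        algebraMap F E (herm (RingHom.id F) a b) := by
      simp [herm, H.conj_algebraMap]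
    have h2 (a : Fin 3 → F) : g.1.1.mulVec (algebraMap F E ∘ a) =
        algebraMap F E ∘ g₀.1.mulVec a := by
      rw [hg]
      exact funext fun i => ((algebraMap F E).map_mulVec g₀.1 a i).symm
    rw [← h1, ← h1, ← h2, ← h2]
    exact g.2 _ _
  have hfix (g₀ : Matrix.SpecialLinearGroup (Fin 3) F) (hg₀ : g₀ ∈ SU (RingHom.id F)) :
      ∃ g : Γ, g.1.1 = Matrix.SpecialLinearGroup.map (algebraMap F E) g₀ ∧
        (g.1.1 • stdLattice O).1 = stdSubmodule O := by
    let g : SU σ := ⟨Matrix.SpecialLinearGroup.map (algebraMap F E) g₀,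
      herm_mulVec_map (algebraMap F E) σ H.conj_algebraMap hg₀⟩
    have hle (g₀ : Matrix.SpecialLinearGroup (Fin 3) F) (x : Fin 3 → E)
        (hx : x ∈ stdSubmodule O) :
        (Matrix.SpecialLinearGroup.map (algebraMap F E) g₀).1.mulVec x ∈ stdSubmodule O := by
      intro i
      change ∑ j, algebraMap F E (g₀.1 i j) * x j ∈ O
      exact O.sum_mem fun j _ => O.mul_mem (H.algebraMap_mem _) (hx j)
    refine ⟨⟨g, hΓ' g g₀ rfl⟩, rfl, le_antisymm ?_ fun x hx => ?_⟩
    · rintro _ ⟨x, hx, rfl⟩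
      exact hle g₀ x hx
    · refine ⟨_, ?_, matAct_inv_cancel g.1 x⟩
      have h1 : g.1⁻¹ = Matrix.SpecialLinearGroup.map (algebraMap F E) g₀⁻¹ := (map_inv _ _).symm
      rw [h1]
      exact hle _ x hx
  -- The square class of `q` is a complete invariant. One direction lifts an isometry over `F` to
  -- `Γ`; in the other, the stabilizer preserves `q` and rescaling by `u` multiplies it by `u²`.
  have hcls (w w' : IsotropicVector O σ ϖ) :
      squareClass (herm (RingHom.id k) (val w) (val w)) =
        squareClass (herm (RingHom.id k) (val w') (val w')) ↔
      ∃ g : Γ, (treeAction O Γ).actE.smul g (w.dart HL) = w'.dart HL := by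
    rw [squareClass_eq_iff hQ.two_ne']
    constructor
    · rintro ⟨h1, h2⟩
      obtain ⟨g₀, hg₀, u, hu, e⟩ := hQ.exists_isometry_of_form (hval_ne w) (hval_ne w')
        (hval_herm w) (hval_herm w') h1 h2
      obtain ⟨g, hg, hstd⟩ := hfix g₀ hg₀
      refine ⟨g, ?_⟩
      refine (IsotropicVector.smul_dart HL w g hstd).trans ((hval_eq _ _).2 ⟨u⁻¹, ?_⟩)
      rw [hval_smul w g.1 hstd g₀ hg, e, smul_smul, inv_mul_cancel₀ hu, one_smul]
    · rintro ⟨g, hg⟩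
      have hstd : (g.1.1 • stdLattice O).1 = stdSubmodule O :=
        HL.smul_std_eq (congrArg (fun a : (tree O σ).Dart => a.fst) hg)
      obtain ⟨g₀, hg₀⟩ := hΓ g.1 g.2 fun i j => by
        have h1 := (mulVec_mem_std_iff hstd _).2 (single_mem_std (O := O) j) i
        simpa using h1
      obtain ⟨u, hu⟩ := (hval_eq _ _).1 ((IsotropicVector.smul_dart HL w g hstd).symm.trans hg)
      rw [hval_smul w g.1 hstd g₀ hg₀] at hu
      have hu0 : u ≠ 0 := by
        rintro rfl
        exact hval_ne w' (by rw [hu, zero_smul])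
      have h1 : herm (RingHom.id k) (val w') (val w') =
          u ^ 2 * herm (RingHom.id k) (val w) (val w) := by
        rw [hu, herm_smul_left, herm_smul_right,
          herm_mulVec_map (algebraMap F k) (RingHom.id k) (fun a => rfl) (hisom g.1 g₀ hg₀)]
        simp only [RingHom.id_apply]
        ring
      rw [h1]
      refine ⟨by simp [hu0], u * herm (RingHom.id k) (val w) (val w), by ring⟩
  have hdart (a : (tree O σ).Dart) : ∃ w : IsotropicVector O σ ϖ,
      a.fst = specialVertex O σ H.conj_mem → a = w.dart HL := by
    by_cases ha : a.fst = specialVertex O σ H.conj_mem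
    · obtain ⟨w, hw⟩ := IsotropicVector.exists_dart HL a ha
      exact ⟨w, fun _ => hw⟩
    -- Edges with another source receive an arbitrary isotropic vector, so that `W` is defined
    -- everywhere.
    · obtain ⟨v, hv, hv', -⟩ := hQ.exists_isotropic (one_ne_zero)
      obtain ⟨w, -⟩ := hval_surj v hv hv'
      exact ⟨w, fun h => (ha h).elim⟩
  choose W hW using hdart
  refine (treeAction O Γ).valency_mkV_eq_three _
    (fun a => squareClass (herm (RingHom.id k) (val (W a)) (val (W a)))) (fun a b ha hb => ?_)
    fun i => ?_
  · have h1 := hcls (W a) (W b)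
    rw [← hW a ha, ← hW b hb] at h1
    exact h1
  · have hex (v : Fin 3 → k) (hv : v ≠ 0) (hv' : herm s v v = 0) :
        ∃ a : (tree O σ).Dart, a.fst = specialVertex O σ H.conj_mem ∧
          squareClass (herm (RingHom.id k) (val (W a)) (val (W a))) =
            squareClass (herm (RingHom.id k) v v) := by
      obtain ⟨w, rfl⟩ := hval_surj v hv hv'
      -- The vector chosen by `W` may differ from `w`, but both give the same edge, so the identity
      -- of `Γ` relates them.
      refine ⟨w.dart HL, rfl, (hcls _ _).2 ⟨1, ?_⟩⟩
      rw [← hW (w.dart HL) rfl]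
      exact (treeAction O Γ).actE.one_smul _
    have hnz (β : k) (hβ : β ≠ 0) : ∃ a : (tree O σ).Dart,
        a.fst = specialVertex O σ H.conj_mem ∧
          squareClass (herm (RingHom.id k) (val (W a)) (val (W a))) = squareClass β := by
      obtain ⟨v, hv, hv', h0, hsq⟩ := hQ.exists_isotropic hβ
      obtain ⟨a, ha, ha'⟩ := hex v hv hv'
      refine ⟨a, ha, ha'.trans ((squareClass_eq_iff hQ.two_ne' _ _).2 ⟨by simp [h0, hβ], hsq⟩)⟩
    -- Representatives of the classes: `e₀` for zero, then vectors obtained from `β = 1` and from a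
    -- nonsquare `β`.
    fin_cases i
    · obtain ⟨a, ha, ha'⟩ := hex (Pi.single 0 1) (by simp) (by simp [herm])
      refine ⟨a, ha, ha'.trans ?_⟩
      simp [herm, squareClass]
    · obtain ⟨a, ha, ha'⟩ := hnz 1 one_ne_zero
      refine ⟨a, ha, ha'.trans ?_⟩
      simp [squareClass]
    · have hc : ringChar k ≠ 2 := by
        intro h
        exact hQ.two_ne' (by simpa [h] using ringChar.Nat.cast_ringChar (R := k))
      obtain ⟨β, hβ⟩ := FiniteField.exists_nonsquare hc
      have hβ0 : β ≠ 0 := by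
        rintro rfl
        exact hβ IsSquare.zero
      obtain ⟨a, ha, ha'⟩ := hnz β hβ0
      refine ⟨a, ha, ha'.trans ?_⟩
      simp [squareClass, hβ, hβ0]

/-! ### Galois theory of the quadratic extension -/

section Quadratic

variable {K L : Type*} [Field K] [Field L] [Algebra K L]

lemma card_aut_of_finrank_eq_two (hL : Module.finrank K L = 2) {τ : L ≃ₐ[K] L} (hτ : τ ≠ 1) :
    Nat.card (L ≃ₐ[K] L) = 2 := by
  have : FiniteDimensional K L := Module.finite_of_finrank_pos (by omega)
  refine le_antisymm ?_ ?_
  · rw [Nat.card_eq_fintype_card, ← hL]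
    exact AlgEquiv.card_le
  · have : Nontrivial (L ≃ₐ[K] L) := ⟨⟨τ, 1, hτ⟩⟩
    exact Finite.one_lt_card

lemma involutive_of_finrank_eq_two (hL : Module.finrank K L = 2) {τ : L ≃ₐ[K] L} (hτ : τ ≠ 1)
    (x : L) : τ (τ x) = x := by
  have h := pow_card_eq_one' (x := τ)
  rw [card_aut_of_finrank_eq_two hL hτ, sq] at h
  exact DFunLike.congr_fun h x

lemma exists_algebraMap_of_fixed (hL : Module.finrank K L = 2) {τ : L ≃ₐ[K] L} (hτ : τ ≠ 1)
    {x : L} (hx : τ x = x) : ∃ a : K, algebraMap K L a = x := by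
  have : FiniteDimensional K L := Module.finite_of_finrank_pos (by omega)
  have hcard := card_aut_of_finrank_eq_two hL hτ
  have : IsGalois K L := IsGalois.of_card_aut_eq_finrank K L (hcard.trans hL.symm)
  refine IntermediateField.mem_bot.1 ((IsGalois.mem_bot_iff_fixed x).2 fun f => ?_)
  by_cases hf : f = 1
  · rw [hf]
    rfl
  · obtain ⟨y, z, -, h⟩ := Nat.card_eq_two_iff.1 hcard
    have h1 (g : L ≃ₐ[K] L) : g = y ∨ g = z := by
      have : g ∈ ({y, z} : Set (L ≃ₐ[K] L)) := h ▸ Set.mem_univ g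
      simpa using this
    have : f = τ := by
      rcases h1 f with h2 | h2 <;> rcases h1 τ with h3 | h3 <;> rcases h1 1 with h4 | h4 <;>
        simp_all
    rw [this, hx]

end Quadratic

/-! ### Places, constants and the square root generating the extension -/

section Places

variable {F K L : Type*} [Field F] [Field K] [Field L] [Algebra F K] [Algebra F L] [Algebra K L]
  [IsScalarTower F K L]

lemma Place.ext {P P' : Place F K} (h : P.ring = P'.ring) : P = P' := by
  cases P
  cases P'
  congr

/-- The functions that have no poles are algebraic over the field of constants. -/
lemma isIntegral_of_forall_mem {x : K} (h : ∀ P : Place F K, x ∈ P.ring) : IsIntegral F x := by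
  by_contra hx
  have hx' : x ∉ (integralClosure F K).toSubring := hx
  have : IsIntegrallyClosedIn (integralClosure F K).toSubring K :=
    inferInstanceAs (IsIntegrallyClosedIn (integralClosure F K) K)
  -- An integrally closed subring is an intersection of valuation rings. One that omits `x` is
  -- proper and contains `F`: it is a place where `x` has a pole.
  obtain ⟨V, hV, hxV⟩ := Subring.exists_le_valuationSubring_of_isIntegrallyClosedIn hx'
  exact hxV (h ⟨V, fun a => hV (isIntegral_algebraMap (R := F) (A := K)),
    fun hV' => hxV (hV' ▸ ValuationSubring.mem_top x)⟩)

variable {P : Place F K} {Q : Place F L}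

lemma Place.valuation_algebraMap_le (P : Place F K) (a : F) :
    P.ring.valuation (algebraMap F K a) ≤ 1 :=
  (P.ring.valuation_le_one_iff _).2 (P.algebraMap_mem a)

lemma Place.valuation_algebraMap (P : Place F K) {a : F} (ha : a ≠ 0) :
    P.ring.valuation (algebraMap F K a) = 1 := by
  refine le_antisymm (P.valuation_algebraMap_le a) ?_
  have h := P.valuation_algebraMap_le a⁻¹
  have h0 : P.ring.valuation (algebraMap F K a) ≠ 0 := by simpa using ha
  rw [map_inv₀, map_inv₀] at h
  exact (inv_le_one₀ (zero_lt_iff.2 h0)).1 h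

/-- At a place of degree one, every regular function is congruent to a constant. -/
lemma Place.exists_const (hP : P.degree = 1) {x : K} (hx : x ∈ P.ring) :
    ∃ a : F, P.ring.valuation (x - algebraMap F K a) < 1 := by
  obtain ⟨a, ha⟩ := (finrank_eq_one_iff_of_nonzero' (1 : IsLocalRing.ResidueField P.ring)
    one_ne_zero).1 hP (IsLocalRing.residue P.ring ⟨x, hx⟩)
  refine ⟨a, (P.ring.valuation_lt_one_iff (⟨x, hx⟩ - algebraMap F P.ring a)).1 ?_⟩
  rw [← IsLocalRing.residue_eq_zero_iff, map_sub, ← ha, sub_eq_zero, Algebra.smul_def, mul_one]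
  rfl

/-- At a place of degree two, some regular function is not congruent to a constant. -/
lemma Place.exists_not_const (hP : P.degree = 2) :
    ∃ x ∈ P.ring, ∀ a : F, ¬ P.ring.valuation (x - algebraMap F K a) < 1 := by
  by_contra! h
  have := finrank_le_one (R := F) (1 : IsLocalRing.ResidueField P.ring) fun w => by
    obtain ⟨x, rfl⟩ := IsLocalRing.residue_surjective w
    obtain ⟨a, ha⟩ := h x x.2
    refine ⟨a, ?_⟩
    have h1 := (P.ring.valuation_lt_one_iff (x - algebraMap F P.ring a)).2 ha
    rw [← IsLocalRing.residue_eq_zero_iff, map_sub, sub_eq_zero] at h1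
    rw [h1, Algebra.smul_def, mul_one]
    rfl
  have h2 : Module.finrank F (IsLocalRing.ResidueField P.ring) = 2 := hP
  omega

omit [IsScalarTower F K L] in
lemma Place.mem_iff_of_unique
    (hQ : ∀ Q' : Place F L, Q'.ring.comap (algebraMap K L) = P.ring ↔ Q' = Q) (x : K) :
    algebraMap K L x ∈ Q.ring ↔ x ∈ P.ring := by
  rw [← (hQ Q).2 rfl]
  rfl

omit [IsScalarTower F K L] in
lemma Place.valuation_lt_one_of_unique
    (hQ : ∀ Q' : Place F L, Q'.ring.comap (algebraMap K L) = P.ring ↔ Q' = Q) {x : K}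
    (hx : P.ring.valuation x < 1) : Q.ring.valuation (algebraMap K L x) < 1 := by
  by_cases h0 : x = 0
  · simp [h0]
  · by_contra! h
    have h1 : Q.ring.valuation (algebraMap K L x)⁻¹ ≤ 1 := by
      rw [map_inv₀]
      exact inv_le_one_of_one_le₀ h
    rw [ValuationSubring.valuation_le_one_iff, ← map_inv₀, Place.mem_iff_of_unique hQ,
      ← ValuationSubring.valuation_le_one_iff, map_inv₀, inv_le_one₀] at h1
    · exact hx.not_ge h1
    · exact zero_lt_iff.2 (by simpa using h0)

/-- The pullback of `Q` along `τ` is again a place above `P`, hence is `Q`. -/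
lemma Place.conj_mem_of_unique
    (hQ : ∀ Q' : Place F L, Q'.ring.comap (algebraMap K L) = P.ring ↔ Q' = Q) (τ : L ≃ₐ[K] L)
    {x : L} (hx : x ∈ Q.ring) : τ x ∈ Q.ring := by
  let Q' : Place F L :=
    { ring := Q.ring.comap (τ : L →+* L)
      algebraMap_mem := fun a => by
        rw [ValuationSubring.mem_comap, IsScalarTower.algebraMap_apply F K L]
        change τ _ ∈ _
        rw [τ.commutes, ← IsScalarTower.algebraMap_apply F K L]
        exact Q.algebraMap_mem a
      ne_top := fun h => Q.ne_top (by
        rw [eq_top_iff]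
        intro y _
        have : τ.symm y ∈ Q.ring.comap (τ : L →+* L) := h ▸ ValuationSubring.mem_top _
        rw [ValuationSubring.mem_comap] at this
        change τ _ ∈ _ at this
        rwa [τ.apply_symm_apply] at this) }
  have h : Q' = Q := by
    refine (hQ Q').1 ?_
    rw [← (hQ Q).2 rfl]
    ext y
    change τ (algebraMap K L y) ∈ Q.ring ↔ algebraMap K L y ∈ Q.ring
    rw [τ.commutes]
  have h1 : x ∈ Q'.ring := h ▸ hx
  exact h1

/-- A quadratic extension with an inert place of degree one is generated by the square root of a
function congruent to a constant that is not a square. -/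
lemma Place.exists_sqrt (h2 : (2 : F) ≠ 0) (hL : Module.finrank K L = 2) {τ : L ≃ₐ[K] L}
    (hτ : τ ≠ 1) (hQ : ∀ Q' : Place F L, Q'.ring.comap (algebraMap K L) = P.ring ↔ Q' = Q)
    (hPdeg : P.degree = 1) (hQdeg : Q.degree = 2) :
    ∃ (θ : L) (δ : K) (d : F), τ θ = -θ ∧ θ ^ 2 = algebraMap K L δ ∧
      P.ring.valuation (δ - algebraMap F K d) < 1 ∧ ¬ IsSquare d := by
  obtain ⟨u, hu, hu'⟩ := Place.exists_not_const hQdeg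
  have hττ := involutive_of_finrank_eq_two hL hτ
  have hτu := Place.conj_mem_of_unique hQ τ hu
  have hF (a : F) : algebraMap F L a = algebraMap K L (algebraMap F K a) :=
    IsScalarTower.algebraMap_apply F K L a
  obtain ⟨s, hs⟩ := exists_algebraMap_of_fixed hL hτ (x := u + τ u) (by
    rw [map_add, hττ, add_comm])
  have hsP : s ∈ P.ring := by
    rw [← Place.mem_iff_of_unique hQ, hs]
    exact add_mem hu hτu
  obtain ⟨c, hc⟩ := Place.exists_const hPdeg hsP
  have hc' := Place.valuation_lt_one_of_unique hQ hc
  -- As `u + τu` is congruent to the constant `c`, a congruence `u - τu ≡ a` would give `u ≡ (a +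
  -- c)/2`, against the choice of `u`.
  have hθ (a : F) : ¬ Q.ring.valuation (u - τ u - algebraMap F L a) < 1 := by
    intro ha
    refine hu' ((a + c) / 2) ?_
    have h3 : algebraMap F L 2 * (u - algebraMap F L ((a + c) / 2)) =
        (u - τ u - algebraMap F L a) + algebraMap K L (s - algebraMap F K c) := by
      rw [mul_sub, ← map_mul, mul_div_cancel₀ _ h2, map_sub, hs, ← hF, map_add, map_ofNat]
      ring
    have h4 := congrArg Q.ring.valuation h3
    rw [map_mul, Q.valuation_algebraMap h2, one_mul] at h4
    rw [h4]
    exact Valuation.map_add_lt _ ha hc'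
  have hθm : u - τ u ∈ Q.ring := sub_mem hu hτu
  obtain ⟨δ, hδ⟩ := exists_algebraMap_of_fixed hL hτ (x := (u - τ u) ^ 2) (by
    rw [map_pow, map_sub, hττ]
    ring)
  have hδP : δ ∈ P.ring := by
    rw [← Place.mem_iff_of_unique hQ, hδ]
    exact pow_mem hθm 2
  obtain ⟨d, hd⟩ := Place.exists_const hPdeg hδP
  refine ⟨u - τ u, δ, d, by rw [map_sub, hττ, neg_sub], hδ.symm, hd, ?_⟩
  -- If `d = r²`, then `(θ - r)(θ + r)` vanishes at `Q`, so `θ` is congruent to `r` or `-r`, which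
  -- `hθ` forbids.
  rintro ⟨r, rfl⟩
  have h5 := Place.valuation_lt_one_of_unique hQ hd
  have h6 : algebraMap K L (δ - algebraMap F K (r * r)) =
      (u - τ u - algebraMap F L r) * (u - τ u - algebraMap F L (-r)) := by
    rw [map_sub, hδ, ← hF, map_mul, map_neg]
    ring
  rw [h6, map_mul] at h5
  exact h5.not_ge (one_le_mul_of_one_le_of_one_le (not_lt.1 (hθ r)) (not_lt.1 (hθ (-r))))

lemma Place.isIntegral_mem {x : K} (hx : IsIntegral P.affineRing x) {P' : Place F K}
    (h : P' ≠ P) : x ∈ P'.ring := by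
  have hle : P.affineRing ≤ P'.ring.toSubring := fun y hy => hy P' h
  have h1 : IsIntegral P'.ring x :=
    hx.map_of_comp_eq (Subring.inclusion hle) (RingHom.id K) rfl
  obtain ⟨y, rfl⟩ := IsIntegrallyClosed.isIntegral_iff.1 h1
  exact y.2

/-- The elements of `B` whose trace and norm are regular at `P` are constants. -/
lemma Place.exists_const_of_mem_integralRing (h2 : (2 : F) ≠ 0) (hL : Module.finrank K L = 2)
    (hFL : ∀ x : L, IsAlgebraic F x → x ∈ (algebraMap F L).range) {τ : L ≃ₐ[K] L} (hτ : τ ≠ 1)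
    {x : L} (hx : x ∈ P.integralRing L)
    (hP : ∀ a : K, algebraMap K L a = x + τ x ∨ algebraMap K L a = x * τ x → a ∈ P.ring) :
    ∃ a : F, algebraMap F L a = x := by
  have hττ := involutive_of_finrank_eq_two hL hτ
  have hx' : IsIntegral P.affineRing x := hx
  have hτx : IsIntegral P.affineRing (τ x) :=
    hx'.map (τ.toAlgHom.restrictScalars P.affineRing)
  have hint (a : K) (ha : algebraMap K L a = x + τ x ∨ algebraMap K L a = x * τ x) :
      IsIntegral F (algebraMap K L a) := by
    refine IsIntegral.algebraMap (isIntegral_of_forall_mem fun P' => ?_)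
    by_cases h : P' = P
    · exact h ▸ hP a ha
    · refine Place.isIntegral_mem ?_ h
      refine (isIntegral_algebraMap_iff (B := L) (algebraMap K L).injective).1 ?_
      rcases ha with ha | ha
      · exact ha ▸ hx'.add hτx
      · exact ha ▸ hx'.mul hτx
  obtain ⟨t, ht⟩ := exists_algebraMap_of_fixed hL hτ (x := x + τ x) (by
    rw [map_add, hττ, add_comm])
  obtain ⟨n, hn⟩ := exists_algebraMap_of_fixed hL hτ (x := x * τ x) (by
    rw [map_mul, hττ, mul_comm])
  have h1 := hint t (Or.inl ht)
  have h3 := hint n (Or.inr hn)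
  have h4 : algebraMap F L 2 ≠ 0 := (map_ne_zero _).2 h2
  -- Trace `t` and norm `n` have no poles, so they are algebraic over `F`; completing the square
  -- gives `(x - t/2)² = (t/2)² - n`.
  have h5 : IsIntegral F (x - algebraMap F L 2⁻¹ * algebraMap K L t) := by
    refine IsIntegral.of_pow (n := 2) two_pos ?_
    have h6 : (x - algebraMap F L 2⁻¹ * algebraMap K L t) ^ 2 =
        (algebraMap F L 2⁻¹ * algebraMap K L t) ^ 2 - algebraMap K L n := by
      have h7 : algebraMap F L 2⁻¹ * 2 = 1 := by
        rw [← map_ofNat (algebraMap F L) 2, ← map_mul, inv_mul_cancel₀ h2, map_one]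
      rw [ht, hn]
      linear_combination -x * (x + τ x) * h7
    rw [h6]
    exact ((isIntegral_algebraMap.mul h1).pow 2).sub h3
  have h8 := h5.add ((isIntegral_algebraMap (R := F) (x := (2 : F)⁻¹)).mul h1)
  rw [sub_add_cancel] at h8
  exact hFL x h8.isAlgebraic

end Places

open IsDedekindDomain HeightOneSpectrum

/-! ### The completion at a place and its constants -/

section Completion

variable {F K : Type*} [Field F] [Field K] [Algebra F K] (P : Place F K)
  [IsDiscreteValuationRing P.ring]

lemma Place.valued_algebraMap (x : K) : Valued.v (algebraMap K P.Completion x) =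
    (IsDiscreteValuationRing.maximalIdeal P.ring).valuation K x := by
  rw [algebraMap_adicCompletion]
  exact valuedAdicCompletion_eq_valuation' _ x

lemma Place.valued_le_one_iff (x : K) :
    Valued.v (algebraMap K P.Completion x) ≤ 1 ↔ x ∈ P.ring := by
  rw [P.valued_algebraMap]
  constructor
  · intro h
    obtain ⟨a, rfl⟩ := IsDiscreteValuationRing.exists_lift_of_le_one h
    exact a.2
  · intro h
    exact valuation_le_one _ (⟨x, h⟩ : P.ring)

lemma Place.valued_lt_one {x : K} (hx : P.ring.valuation x < 1) :
    Valued.v (algebraMap K P.Completion x) < 1 := by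
  rw [P.valued_algebraMap]
  have h : x ∈ P.ring := (P.ring.valuation_le_one_iff x).1 hx.le
  exact (valuation_lt_one_iff_mem _ (⟨x, h⟩ : P.ring)).2
    ((P.ring.valuation_lt_one_iff ⟨x, h⟩).2 hx)

lemma Place.valued_const {a : F} (ha : a ≠ 0) : Valued.v (algebraMap F P.Completion a) = 1 := by
  have hle (a : F) : Valued.v (algebraMap F P.Completion a) ≤ 1 := by
    rw [IsScalarTower.algebraMap_apply F K P.Completion, P.valued_le_one_iff]
    exact P.algebraMap_mem a
  refine le_antisymm (hle a) ?_
  have h := hle a⁻¹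
  have h0 : Valued.v (algebraMap F P.Completion a) ≠ 0 := by simpa using ha
  rw [map_inv₀, map_inv₀] at h
  exact (inv_le_one₀ (zero_lt_iff.2 h0)).1 h

/-- By density of `K`, `x` is congruent to an element of `K`, for which the degree one condition
gives the constant. -/
lemma Place.exists_const_completion (hP : P.degree = 1) {x : P.Completion}
    (hx : Valued.v x ≤ 1) : ∃ a : F, Valued.v (x - algebraMap F P.Completion a) < 1 := by
  have hopen : IsOpen {y : P.Completion | Valued.v (x - y) < 1} := by
    have h := (Valued.isOpen_ball P.Completion 1).preimage (continuous_const.sub continuous_id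
      (X := P.Completion) (f := fun _ => x))
    convert h using 1
    ext y
    simp
  obtain ⟨y, hy⟩ := (denseRange_algebraMap K
    (IsDiscreteValuationRing.maximalIdeal P.ring)).exists_mem_open hopen ⟨x, by simp⟩
  have hy1 : Valued.v (algebraMap K P.Completion y) ≤ 1 := by
    have : algebraMap K P.Completion y = x - (x - algebraMap K P.Completion y) := by ring
    rw [this]
    exact (Valuation.map_sub _ _ _).trans (max_le hx (le_of_lt hy))
  obtain ⟨a, ha⟩ := Place.exists_const hP ((P.valued_le_one_iff y).1 hy1)
  refine ⟨a, ?_⟩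
  have : x - algebraMap F P.Completion a = (x - algebraMap K P.Completion y) +
      algebraMap K P.Completion (y - algebraMap F K a) := by
    rw [map_sub, ← IsScalarTower.algebraMap_apply F K P.Completion]
    ring
  rw [this]
  exact Valuation.map_add_lt _ hy (P.valued_lt_one ha)

lemma Place.isIntegral_completion_iff {x : P.Completion} :
    IsIntegral P.integers x ↔ Valued.v x ≤ 1 := by
  rw [IsIntegrallyClosed.isIntegral_iff]
  constructor
  · rintro ⟨y, rfl⟩
    exact y.2
  · exact fun h => ⟨⟨x, h⟩, rfl⟩

end Completion

/-! ### Unramified quadratic extensions from a valuation -/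

/-- The unramified quadratic extension of a discretely valued field with residue field `F`. -/
lemma isUnramifiedDatum_of_valuation {F C E : Type*} [Field F] [Field C] [CommRing E] [Algebra F C]
    [Algebra C E] [Algebra F E] [IsScalarTower F C E] (w : Valuation C (WithZero (Multiplicative ℤ)))
    {O : Subring E} {σ : E →+* E} {θ : E} {δ π : C} {d : F}
    (h2 : (2 : F) ≠ 0) (hd : ¬ IsSquare d)
    (hconst : ∀ a : F, a ≠ 0 → w (algebraMap F C a) = 1)
    (hres : ∀ x : C, w x ≤ 1 → ∃ a : F, w (x - algebraMap F C a) < 1)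
    (hπ : w π = WithZero.exp (-1)) (hπ0 : π ≠ 0) (hδ : w (δ - algebraMap F C d) < 1)
    (hdecomp : ∀ e : E, ∃ a b : C, e = algebraMap C E a + algebraMap C E b * θ)
    (hσC : ∀ a : C, σ (algebraMap C E a) = algebraMap C E a) (hσθ : σ θ = -θ)
    (hθ : θ ^ 2 = algebraMap C E δ)
    (hOC : ∀ a : C, algebraMap C E a ∈ O ↔ w a ≤ 1) (hOsq : ∀ x : E, x ^ 2 ∈ O → x ∈ O)
    (hOσ : ∀ x ∈ O, σ x ∈ O) :
    IsUnramifiedDatum F O σ (Units.map (algebraMap C E).toMonoidHom (Units.mk0 π hπ0)) θ d := by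
  have hconst' (a : F) : w (algebraMap F C a) ≤ 1 := by
    by_cases ha : a = 0
    · simp [ha]
    · exact (hconst a ha).le
  have hmul {x y : C} (hx : w x < 1) (hy : w y ≤ 1) : w (x * y) < 1 := by
    rw [map_mul]
    exact (mul_le_of_le_one_right' hy).trans_lt hx
  have hd0 : d ≠ 0 := by
    rintro rfl
    exact hd IsSquare.zero
  have hδ1 : w δ = 1 := by
    have : δ = algebraMap F C d + (δ - algebraMap F C d) := by ring
    rw [this, Valuation.map_add_eq_of_lt_left _ (by rwa [hconst d hd0]), hconst d hd0]
  have hw2 : w 2 = 1 := by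
    rw [← map_ofNat (algebraMap F C) 2]
    exact hconst 2 h2
  have hθO : θ ∈ O := hOsq θ (by
    rw [hθ, hOC]
    exact hδ1.le)
  -- The trace `2a` bounds `a`, as `2` is a unit; then `(bθ)² = b²δ` bounds `b`, as `δ` is a unit.
  have hO (a b : C) : algebraMap C E a + algebraMap C E b * θ ∈ O ↔ w a ≤ 1 ∧ w b ≤ 1 := by
    constructor
    · intro h
      have h3 : w a ≤ 1 := by
        have h4 := O.add_mem h (hOσ _ h)
        have h5 : algebraMap C E a + algebraMap C E b * θ +
            σ (algebraMap C E a + algebraMap C E b * θ) = algebraMap C E (2 * a) := by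
          rw [map_add, map_mul, hσC, hσC, hσθ, map_mul, map_ofNat]
          ring
        rwa [h5, hOC, map_mul, hw2, one_mul] at h4
      refine ⟨h3, ?_⟩
      have h4 := O.pow_mem (O.sub_mem h ((hOC a).2 h3)) 2
      rwa [add_sub_cancel_left, mul_pow, hθ, ← map_pow, ← map_mul, hOC, map_mul, hδ1, mul_one,
        map_pow, pow_le_one_iff two_ne_zero] at h4
    · exact fun h => O.add_mem ((hOC a).2 h.1) (O.mul_mem ((hOC b).2 h.2) hθO)
  have hzpow (n : ℤ) : (((Units.map (algebraMap C E).toMonoidHom (Units.mk0 π hπ0)) ^ n : Eˣ) : E)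
      = algebraMap C E (π ^ n) := by
    rw [← map_zpow]
    change algebraMap C E ((Units.mk0 π hπ0 ^ n : Cˣ) : C) = _
    rw [Units.val_zpow_eq_zpow_val]
    rfl
  have hinv : (((Units.map (algebraMap C E).toMonoidHom (Units.mk0 π hπ0))⁻¹ : Eˣ) : E)
      = algebraMap C E π⁻¹ := by
    have := hzpow (-1)
    rwa [zpow_neg_one, zpow_neg_one] at this
  have hwn (n : ℤ) : w (π ^ n) = WithZero.exp (-n) := by
    rw [map_zpow₀, hπ, ← WithZero.exp_zsmul]
    simp
  have hdiv {x : C} (hx : w x < 1) : w (π⁻¹ * x) ≤ 1 := by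
    rw [map_mul, map_inv₀, hπ, WithZero.exp_neg, inv_inv, mul_comm]
    by_cases hx0 : w x = 0
    · simp [hx0]
    · rw [← WithZero.exp_log hx0] at hx ⊢
      rw [← WithZero.exp_add, ← WithZero.exp_zero, WithZero.exp_le_exp]
      rw [← WithZero.exp_zero, WithZero.exp_lt_exp] at hx
      omega
  refine { unif_mem := ?_, inv_not_mem := ?_, exists_eq := ?_, conj_unif := hσC π,
           conj_conj := ?_, conj_mem := hOσ, two_ne := h2, algebraMap_mem := ?_,
           theta_mem := hθO, conj_theta := hσθ, conj_algebraMap := ?_, sq := ?_,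
           not_isSquare := hd, residue := ?_ }
  · refine (hOC π).2 ?_
    rw [hπ, ← WithZero.exp_zero, WithZero.exp_le_exp]
    omega
  · rw [hinv, hOC, map_inv₀, hπ, ← WithZero.exp_neg, ← WithZero.exp_zero, WithZero.exp_le_exp]
    omega
  · intro x hx
    obtain ⟨a, b, rfl⟩ := hdecomp x
    have hm : max (w a) (w b) ≠ 0 := by
      intro hm
      have ha : w a = 0 := le_antisymm (hm ▸ le_max_left _ _) zero_le
      have hb : w b = 0 := le_antisymm (hm ▸ le_max_right _ _) zero_le
      rw [Valuation.zero_iff] at ha hb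
      exact hx (by simp [ha, hb])
    -- Dividing by this power of `π` leaves two integral coordinates, at least one of which is a
    -- unit.
    obtain ⟨n, hn⟩ : ∃ n : ℤ, w (π ^ n) = max (w a) (w b) :=
      ⟨-WithZero.log (max (w a) (w b)), by rw [hwn, neg_neg, WithZero.exp_log hm]⟩
    have hπn : π ^ n ≠ 0 := zpow_ne_zero n hπ0
    have hpos : 0 < w (π ^ n) := hn ▸ zero_lt_iff.2 hm
    obtain ⟨a', rfl⟩ : ∃ a', a = π ^ n * a' := ⟨a / π ^ n, by field_simp⟩
    obtain ⟨b', rfl⟩ : ∃ b', b = π ^ n * b' := ⟨b / π ^ n, by field_simp⟩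
    rw [map_mul, map_mul] at hn
    have ha' : w a' ≤ 1 := by
      have : w (π ^ n) * w a' ≤ w (π ^ n) * 1 := by
        rw [mul_one]
        exact (le_max_left _ _).trans hn.ge
      exact (mul_le_mul_iff_right₀ hpos).1 this
    have hb' : w b' ≤ 1 := by
      have : w (π ^ n) * w b' ≤ w (π ^ n) * 1 := by
        rw [mul_one]
        exact (le_max_right _ _).trans hn.ge
      exact (mul_le_mul_iff_right₀ hpos).1 this
    have hnot : ¬ (w a' < 1 ∧ w b' < 1) := by
      rintro ⟨h3, h4⟩
      have h5 : max (w (π ^ n) * w a') (w (π ^ n) * w b') < w (π ^ n) * 1 :=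
        max_lt ((mul_lt_mul_iff_right₀ hpos).2 h3) ((mul_lt_mul_iff_right₀ hpos).2 h4)
      rw [mul_one] at h5
      exact h5.ne' hn
    -- Were the norm not a unit, its reduction would give `α² = dβ²` in `F`. As `d` is not a square,
    -- `α = β = 0`, and neither coordinate would be a unit.
    have hN : w (a' ^ 2 - δ * b' ^ 2) = 1 := by
      refine le_antisymm ?_ ?_
      · refine (Valuation.map_sub _ _ _).trans (max_le ?_ ?_)
        · rw [map_pow]
          exact pow_le_one' ha' 2
        · rw [map_mul, hδ1, one_mul, map_pow]
          exact pow_le_one' hb' 2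
      · by_contra! hlt
        obtain ⟨α, hα⟩ := hres a' ha'
        obtain ⟨β, hβ⟩ := hres b' hb'
        have hsum {x y : C} (hx : w x ≤ 1) (hy : w y ≤ 1) : w (x + y) ≤ 1 :=
          (Valuation.map_add _ _ _).trans (max_le hx hy)
        have h0 : w (algebraMap F C (α ^ 2 - d * β ^ 2)) < 1 := by
          have : algebraMap F C (α ^ 2 - d * β ^ 2) = (a' ^ 2 - δ * b' ^ 2) +
              ((δ - algebraMap F C d) * b' ^ 2 +
                ((b' - algebraMap F C β) * ((b' + algebraMap F C β) * algebraMap F C d) -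
                  (a' - algebraMap F C α) * (a' + algebraMap F C α))) := by
            simp only [map_sub, map_mul, map_pow]
            ring
          rw [this]
          refine Valuation.map_add_lt _ hlt (Valuation.map_add_lt _ (hmul hδ ?_)
            ((Valuation.map_sub _ _ _).trans_lt (max_lt (hmul hβ ?_) (hmul hα ?_))))
          · rw [map_pow]
            exact pow_le_one' hb' 2
          · rw [map_mul]
            exact mul_le_one' (hsum hb' (hconst' β)) (hconst' d)
          · exact hsum ha' (hconst' α)
        have h3 : α ^ 2 - d * β ^ 2 = 0 := by
          by_contra h
          exact h0.ne (hconst _ h)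
        have hβ0 : β = 0 := by
          by_contra hβ0
          refine hd ⟨α / β, ?_⟩
          field_simp
          linear_combination -h3
        have hα0 : α = 0 := by simpa [hβ0] using h3
        refine hnot ⟨?_, ?_⟩
        · simpa [hα0] using hα
        · simpa [hβ0] using hβ
    have hN0 : a' ^ 2 - δ * b' ^ 2 ≠ 0 := by
      intro h
      simp [h] at hN
    have hu := (hO a' b').2 ⟨ha', hb'⟩
    -- The inverse is the conjugate divided by the norm.
    have hu' := (hO (a' / (a' ^ 2 - δ * b' ^ 2)) (-b' / (a' ^ 2 - δ * b' ^ 2))).2 ⟨by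
      rwa [map_div₀, hN, div_one], by rwa [map_div₀, hN, div_one, Valuation.map_neg]⟩
    have huu : (algebraMap C E a' + algebraMap C E b' * θ) *
        (algebraMap C E (a' / (a' ^ 2 - δ * b' ^ 2)) +
          algebraMap C E (-b' / (a' ^ 2 - δ * b' ^ 2)) * θ) = 1 := by
      have h3 : algebraMap C E (a' / (a' ^ 2 - δ * b' ^ 2)) =
          algebraMap C E a' * algebraMap C E (a' ^ 2 - δ * b' ^ 2)⁻¹ := by
        rw [← map_mul, div_eq_mul_inv]
      have h4 : algebraMap C E (-b' / (a' ^ 2 - δ * b' ^ 2)) =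
          -algebraMap C E b' * algebraMap C E (a' ^ 2 - δ * b' ^ 2)⁻¹ := by
        rw [← map_neg, ← map_mul, div_eq_mul_inv]
      have h5 : (algebraMap C E a' ^ 2 - algebraMap C E δ * algebraMap C E b' ^ 2) *
          algebraMap C E (a' ^ 2 - δ * b' ^ 2)⁻¹ = 1 := by
        rw [← map_pow, ← map_pow, ← map_mul, ← map_sub, ← map_mul, mul_inv_cancel₀ hN0, map_one]
      rw [h3, h4]
      linear_combination h5 - algebraMap C E b' ^ 2 * algebraMap C E (a' ^ 2 - δ * b' ^ 2)⁻¹ * hθ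
    refine ⟨n, ⟨⟨_, hu⟩, ⟨_, hu'⟩, Subtype.ext huu, Subtype.ext ((mul_comm _ _).trans huu)⟩, ?_⟩
    rw [hzpow, map_mul, map_mul]
    change _ = _ * (_ + _)
    ring
  · intro x
    obtain ⟨a, b, rfl⟩ := hdecomp x
    simp [hσC, hσθ]
  · intro a
    rw [IsScalarTower.algebraMap_apply F C E, hOC]
    exact hconst' a
  · intro a
    rw [IsScalarTower.algebraMap_apply F C E, hσC]
  · rw [hinv, hθ, IsScalarTower.algebraMap_apply F C E, ← map_sub, ← map_mul, hOC]
    exact hdiv hδ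
  · intro x hx
    obtain ⟨a, b, rfl⟩ := hdecomp x
    obtain ⟨ha, hb⟩ := (hO a b).1 hx
    obtain ⟨α, hα⟩ := hres a ha
    obtain ⟨β, hβ⟩ := hres b hb
    refine ⟨α, β, ?_⟩
    have : (((Units.map (algebraMap C E).toMonoidHom (Units.mk0 π hπ0))⁻¹ : Eˣ) : E) *
        (algebraMap C E a + algebraMap C E b * θ - (algebraMap F E α + algebraMap F E β * θ)) =
        algebraMap C E (π⁻¹ * (a - algebraMap F C α)) +
          algebraMap C E (π⁻¹ * (b - algebraMap F C β)) * θ := by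
      rw [hinv, IsScalarTower.algebraMap_apply F C E, IsScalarTower.algebraMap_apply F C E,
        map_mul, map_mul, map_sub, map_sub]
      ring
    rw [this, hO]
    exact ⟨hdiv hα, hdiv hβ⟩

/-! ### The local algebra `L_Q` -/

section LocalAlgebra

variable {F K L : Type*} [Field F] [Field K] [Field L] [Algebra F K] [Algebra F L] [Algebra K L]
  [IsScalarTower F K L] (P : Place F K) [IsDiscreteValuationRing P.ring]

omit [Algebra F L] [IsScalarTower F K L] in
lemma Place.algebraMap_mem_localIntegers (a : P.Completion) :
    algebraMap P.Completion (P.localAlgebra L) a ∈ P.localIntegers L ↔ Valued.v a ≤ 1 := by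
  rw [← P.isIntegral_completion_iff]
  exact isIntegral_algebraMap_iff (algebraMap P.Completion (P.localAlgebra L)).injective

omit [Algebra F L] [IsScalarTower F K L] in
lemma Place.localAlgebra_decomp (hL : Module.finrank K L = 2) {θ : L}
    (hθ : ∀ a : K, algebraMap K L a ≠ θ) (e : P.localAlgebra L) :
    ∃ a b : P.Completion, e = algebraMap P.Completion (P.localAlgebra L) a +
      algebraMap P.Completion (P.localAlgebra L) b * (1 ⊗ₜ[K] θ) := by
  have hli : LinearIndependent K ![(1 : L), θ] := by
    refine LinearIndependent.pair_iff.2 fun s t h => ?_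
    have ht : t = 0 := by
      by_contra ht
      refine hθ (-s / t) ?_
      have : algebraMap K L t ≠ 0 := (map_ne_zero _).2 ht
      rw [Algebra.smul_def, Algebra.smul_def, mul_one] at h
      rw [map_div₀, map_neg]
      field_simp
      linear_combination -h
    subst ht
    simpa [Algebra.smul_def] using h
  let b := basisOfLinearIndependentOfCardEqFinrank hli (by rw [hL]; rfl)
  have hb : ⇑b = ![(1 : L), θ] := coe_basisOfLinearIndependentOfCardEqFinrank _ _
  let B := Algebra.TensorProduct.basis P.Completion b
  refine ⟨B.repr e 0, B.repr e 1, ?_⟩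
  conv_lhs => rw [← B.sum_repr e]
  rw [Fin.sum_univ_two, Algebra.TensorProduct.basis_apply, Algebra.TensorProduct.basis_apply, hb,
    Algebra.smul_def, Algebra.smul_def]
  change _ * 1 + _ = _
  rw [mul_one]
  rfl

omit [Algebra F L] [IsScalarTower F K L] in
lemma Place.conj_tmul (τ : L ≃ₐ[K] L) (x : L) :
    (P.conj τ).toRingHom (1 ⊗ₜ[K] x) = 1 ⊗ₜ[K] τ x := rfl

omit [Algebra F L] [IsScalarTower F K L] in
lemma Place.tmul_algebraMap (a : K) : (1 ⊗ₜ[K] algebraMap K L a : P.localAlgebra L) =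
    algebraMap P.Completion (P.localAlgebra L) (algebraMap K P.Completion a) :=
  (Algebra.TensorProduct.includeRight : L →ₐ[K] P.localAlgebra L).commutes a

lemma Place.tmul_const (a : F) : (1 ⊗ₜ[K] algebraMap F L a : P.localAlgebra L) =
    algebraMap F (P.localAlgebra L) a := by
  rw [IsScalarTower.algebraMap_apply F K L, P.tmul_algebraMap,
    ← IsScalarTower.algebraMap_apply F K P.Completion,
    ← IsScalarTower.algebraMap_apply F P.Completion (P.localAlgebra L)]

/-- An element of `B` that is integral at `P` is a constant. -/
lemma Place.exists_const_of_mem_localIntegers (h2 : (2 : F) ≠ 0) (hL : Module.finrank K L = 2)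
    (hFL : ∀ x : L, IsAlgebraic F x → x ∈ (algebraMap F L).range) {τ : L ≃ₐ[K] L} (hτ : τ ≠ 1)
    {x : L} (hx : x ∈ P.integralRing L)
    (hxP : (1 ⊗ₜ[K] x : P.localAlgebra L) ∈ P.localIntegers L) :
    ∃ a : F, algebraMap F L a = x := by
  refine P.exists_const_of_mem_integralRing h2 hL hFL hτ hx fun a ha => ?_
  have hτx := P.conj_mem τ _ hxP
  rw [← P.valued_le_one_iff, ← P.algebraMap_mem_localIntegers (L := L), ← P.tmul_algebraMap]
  rcases ha with ha | ha
  · rw [ha, TensorProduct.tmul_add]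
    exact add_mem hxP hτx
  · have : (1 ⊗ₜ[K] (x * τ x) : P.localAlgebra L) = (1 ⊗ₜ[K] x) * (1 ⊗ₜ[K] τ x) := by
      rw [Algebra.TensorProduct.tmul_mul_tmul, one_mul]
    rw [ha, this]
    exact mul_mem hxP hτx

/-- A uniformizer of `P` serves for `L_Q` too, because `θ²` reduces to a nonsquare. All is computed
in the coordinates `1, θ`, so `L_Q` need not be known to be a field. -/
lemma Place.exists_isUnramifiedDatum {Q : Place F L} (h2 : (2 : F) ≠ 0)
    (hL : Module.finrank K L = 2) {τ : L ≃ₐ[K] L} (hτ : τ ≠ 1)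
    (hQ : ∀ Q' : Place F L, Q'.ring.comap (algebraMap K L) = P.ring ↔ Q' = Q)
    (hPdeg : P.degree = 1) (hQdeg : Q.degree = 2) :
    ∃ ϖ θ d, IsUnramifiedDatum F (P.localIntegers L) (P.conj τ).toRingHom ϖ θ d := by
  obtain ⟨θ, δ, d, hτθ, hθ, hδ, hd⟩ := Place.exists_sqrt h2 hL hτ hQ hPdeg hQdeg
  obtain ⟨π, hπ⟩ := IsDedekindDomain.HeightOneSpectrum.valuation_exists_uniformizer K
    (IsDiscreteValuationRing.maximalIdeal P.ring)
  rw [← P.valued_algebraMap] at hπ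
  have hπ0 : algebraMap K P.Completion π ≠ 0 := by
    intro h
    rw [h, map_zero] at hπ
    exact WithZero.exp_ne_zero hπ.symm
  -- An element of `K` negated by `τ` is zero, whereas `θ² = δ` is congruent to `d ≠ 0`.
  have hθK (a : K) : algebraMap K L a ≠ θ := by
    rintro rfl
    rw [τ.commutes] at hτθ
    have h2L : (2 : L) ≠ 0 := by
      rw [← map_ofNat (algebraMap F L) 2]
      exact (map_ne_zero _).2 h2
    have h0 : algebraMap K L a = 0 := by
      have h3 : 2 * algebraMap K L a = 0 := by linear_combination hτθ
      exact (mul_eq_zero.1 h3).resolve_left h2L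
    have hδ0 : δ = 0 := by
      rw [h0, eq_comm, zero_pow two_ne_zero] at hθ
      simpa using hθ
    have hd0 : d ≠ 0 := by
      rintro rfl
      exact hd IsSquare.zero
    rw [hδ0, zero_sub, Valuation.map_neg, P.valuation_algebraMap hd0] at hδ
    exact lt_irrefl _ hδ
  refine ⟨_, (1 ⊗ₜ[K] θ : P.localAlgebra L), d,
    isUnramifiedDatum_of_valuation (C := P.Completion) Valued.v
      (δ := algebraMap K P.Completion δ) h2 hd (fun a ha => P.valued_const ha)
      (fun x hx => P.exists_const_completion hPdeg hx) hπ hπ0 ?_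
      (P.localAlgebra_decomp hL hθK) (P.conj τ).commutes ?_ ?_
      P.algebraMap_mem_localIntegers (fun x hx => ?_) (P.conj_mem τ)⟩
  · rw [IsScalarTower.algebraMap_apply F K P.Completion, ← map_sub]
    exact P.valued_lt_one hδ
  · rw [P.conj_tmul, hτθ, TensorProduct.tmul_neg]
  · rw [← P.tmul_algebraMap, ← hθ, sq, sq, Algebra.TensorProduct.tmul_mul_tmul, one_mul]
  · have hx' : IsIntegral P.integers (x ^ 2) := hx
    exact hx'.of_pow two_pos

end LocalAlgebra

end UnitaryTree

/-! ### The stabilizer of the standard vertex consists of constant matrices -/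

theorem proposition11p2
    {F K L : Type*} [Field F] [Finite F] [Field K] [Field L]
    [Algebra F K] [Algebra F L] [Algebra K L] [IsScalarTower F K L]
    (hF : (2 : F) ≠ 0)
    (hK : UnitaryTree.IsCurveFunctionField F K)
    (hL : Module.finrank K L = 2)
    (hFL : ∀ x : L, IsAlgebraic F x → x ∈ (algebraMap F L).range)
    (τ : L ≃ₐ[K] L) (hτ : τ ≠ 1)
    (P : UnitaryTree.Place F K) [IsDiscreteValuationRing P.ring]
    (Q : UnitaryTree.Place F L)
    (hQ : ∀ Q' : UnitaryTree.Place F L,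
      Q'.ring.comap (algebraMap K L) = P.ring ↔ Q' = Q)
    (hPdeg : P.degree = 1) (hQdeg : Q.degree = 2) :
    (P.quotientGraph τ).valency (P.specialVertexImage τ) = 3 := by
  obtain ⟨ϖ, θ, d, H⟩ := P.exists_isUnramifiedDatum hF hL hτ hQ hPdeg hQdeg
  refine H.valency_eq_three (P.arithmeticGroup τ) (fun g hg hO => ?_) fun g g₀ hg => ?_
  · obtain ⟨m, hm⟩ := hg
    have hm' (i j : Fin 3) : (1 ⊗ₜ[K] (m.1 i j : L) : P.localAlgebra L) = g.1.1 i j :=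
      congrArg (fun g : Matrix.SpecialLinearGroup (Fin 3) (P.localAlgebra L) => g.1 i j) hm
    -- Each entry is in `B` and integral at `P`, hence constant; determinant one descends to `F` by
    -- injectivity.
    choose c hc using fun i j => P.exists_const_of_mem_localIntegers hF hL hFL hτ
      (m.1 i j).2 (by
        rw [hm']
        exact hO i j)
    have hcg : (Matrix.of c).map (algebraMap F (P.localAlgebra L)) = g.1.1 := by
      ext i j
      rw [Matrix.map_apply, Matrix.of_apply, ← hm', ← hc, P.tmul_const]
    refine ⟨⟨Matrix.of c, (algebraMap F (P.localAlgebra L)).injective ?_⟩, Subtype.ext hcg.symm⟩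
    rw [RingHom.map_det, map_one, RingHom.mapMatrix_apply, hcg, g.1.2]
  · have hFA (a : F) : algebraMap F L a ∈ P.integralRing L := by
      have h1 : algebraMap F K a ∈ P.affineRing := fun P' _ => P'.algebraMap_mem a
      rw [IsScalarTower.algebraMap_apply F K L]
      exact isIntegral_algebraMap (R := P.affineRing) (A := L) (x := ⟨_, h1⟩)
    refine ⟨Matrix.SpecialLinearGroup.map ((algebraMap F L).codRestrict (P.integralRing L) hFA) g₀,
      ?_⟩
    change _ = g.1
    rw [hg]
    ext i j
    exact P.tmul_const (g₀.1 i j)
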